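/- **Setting.** Let $(\Omega,\mathcal A,P)$ be a probability space with an increasing filtration $(\mathcal P_t)$ and a decreasing filtration $(\mathcal F_t)$, let $I=(a,b)$ with $-\infty<a<b<\infty$, let $d\in\mathbb N$ and $\mu\in\{1,-1\}$. An *S0-process* is a process $X$ on $[a,b]$ with (almost surely) continuous paths such that each $X_t$, $t\in[a,b]$, is $\mathcal P_t$- and $\mathcal F_t$-measurable and square integrable, and $t\mapsto X_t\in L^2(\Omega)$ is continuous on $[a,b]$. It is an *S1-process* if for all $t\in I$ the Nelson derivatives $$DX_t=\lim_{h\to0^+}h^{-1}E[X_{t+h}-X_t\mid\mathcal P_t],\qquad D_*X_t=\lim_{h\to0^+}h^{-1}E[X_t-X_{t-h}\mid\mathcal F_t]$$ exist in $L^2(\Omega)$ and $t\mapsto DX_t$, $t\mapsto D_*X_t$ are continuous from $I$ to $L^2(\Omega)$. $\mathcal C^1(I)$ is the space of $\mathbb R^d$-valued S1-processes with finite norm $\|X\|=\sup_{t\in I}(\|X_t\|_{L^2}+\|DX_t\|_{L^2}+\|D_*X_t\|_{L^2})$; $\mathcal C^1_{\mathbb C}(I)$ is the same for $\mathbb C^d$-valued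 processes. A process given only on $I$, up to null sets at each time (such as $DX$), is said to belong to such a space if it has a version that does. $\mathcal C^{n+1}(I)$, $n\ge1$, is the set of $X\in\mathcal C^1(I)$ with $DX,D_*X\in\mathcal C^n(I)$. Put $\mathcal D_{\mu}=\frac{D+D_*}2+i\mu\frac{D-D_*}2$, for real and for complex processes. When integrated over time, $DX$ and $D_*X$ are taken in jointly measurable versions. An *admissible Lagrangian* is a function $L(x,v)$ on $\mathbb R^d\times\mathbb C^d$ with complex values, holomorphic in $v$. Suppose that $L$ is twice differentiable (in the real sense, jointly in $(x,v)$) with bounded second derivatives. Let $\Xi$ be the set of $X\in\mathcal C^1(I)$ with $E\int_I|L(X_t,\mathcal D_\mu X_t)|\,dt<\infty$, and $F_I(X)=E\int_I L(X_t,\mathcal D_\mu X_t)\,dt$ for $X\in\Xi$. A process $X\in\mathcal C^1(I)$ belongs to the set $\mathcal L$ of *$L$-adapted* processes if $\partial_xL(X_t,\mathcal D_\mu X_t)$ is in $L^2(\Omega)$ and (up to null sets) $\mathcal P_t$- and $\mathcal F_t$-measurable for all $t\in I$, and $\partial_vL(X,\mathcal D_\mu X)\in\mathcal C^1_{\mathbb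 C}(I)$. For $\Gamma\subseteq\mathcal C^1(I)$ put $\Gamma_\Xi=\{Z\in\Gamma: X+Z\in\Xi\ \text{for all}\ X\in\Xi\}$. A process $X$ is *$\Gamma$-critical* for $F_I$ if $X\in\Xi\cap\mathcal L$ and there is a map $dF_I(X,\cdot)$ on $\Gamma_\Xi$, real-linear and with $F_I(X+Z)-F_I(X)=dF_I(X,Z)+o(\|Z\|)$ for $Z\in\Gamma_\Xi$, such that $dF_I(X,Z)=0$ for all $Z\in\Gamma_\Xi$ with $Z(a)=Z(b)=0$ almost surely. **Theorem.** Let $L$ be an admissible Lagrangian with bounded second derivatives and let $X\in\mathcal L\cap\mathcal C^3(I)$. Consider the stochastic Euler–Lagrange equation $$\frac{\partial L}{\partial x}(X_t,\mathcal D_\mu X_t)-\mathcal D_{-\mu}\Big[\frac{\partial L}{\partial v}(X_t,\mathcal D_\mu X_t)\Big]=0\quad\text{almost surely, for every } t\in I.\qquad(\mathrm{EL})$$ 1. If $X$ satisfies (EL), then $X$ is $\mathcal C^1(I)$-critical for $F_I$. 2. If moreover $\partial_xL(X,\mathcal D_\mu X)\in\mathcal C^1_{\mathbb C}(I)$, then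 $X$ is $\mathcal C^1(I)$-critical for $F_I$ if and only if it satisfies (EL). -/

import Mathlib

open MeasureTheory Set Filter Topology
open scoped ENNReal

noncomputable section

namespace StochCV

/-- `ℝ^d` and `ℂ^d` with their Euclidean norms. -/
abbrev RVec (d : ℕ) := EuclideanSpace ℝ (Fin d)

/-- `ℂ^d`. -/
abbrev CVec (d : ℕ) := EuclideanSpace ℂ (Fin d)

/-- The inclusion `ℝ^d ⊆ ℂ^d`. -/
def toC {d : ℕ} (x : RVec d) : CVec d := WithLp.toLp 2 (fun k => (x k : ℂ))

section Processes

/- Throughout, `I = (a, b)`, `past` is the increasing filtration, `fut` the decreasing one.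
A process is a function of time and chance; only its values on `[a, b]` (or on `I`) matter. -/
variable {Ω : Type*} {m0 : MeasurableSpace Ω} (P : Measure Ω)
  (past : Filtration ℝ m0) (fut : Filtration ℝᵒᵈ m0) (a b : ℝ)
  {E : Type*} [NormedAddCommGroup E] [NormedSpace ℝ E] [CompleteSpace E]

/-- S0-processes: continuous sample paths, adapted to both filtrations, square integrable,
and continuous from the closure of `I` to `L²`. -/
structure IsS0 (X : ℝ → Ω → E) : Prop where
  continuous_paths : ∀ᵐ ω ∂P, ContinuousOn (fun t => X t ω) (Icc a b)
  adapted_past : ∀ t ∈ Icc a b, StronglyMeasurable[past t] (X t)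
  adapted_fut : ∀ t ∈ Icc a b, StronglyMeasurable[fut (OrderDual.toDual t)] (X t)
  memLp : ∀ t ∈ Icc a b, MemLp (X t) 2 P
  continuous_L2 : ∀ t ∈ Icc a b,
    Tendsto (fun s => eLpNorm (X s - X t) 2 P) (𝓝[Icc a b] t) (𝓝 0)

/-- `V = DX_t`, that is, `h⁻¹ E[X_{t+h} - X_t | past_t] → V` in `L²` as `h → 0+`. -/
def HasForwardDeriv (X : ℝ → Ω → E) (t : ℝ) (V : Ω → E) : Prop :=
  MemLp V 2 P ∧
    Tendsto (fun h : ℝ =>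
        eLpNorm (h⁻¹ • condExp (past t) P (X (t + h) - X t) - V) 2 P)
      (𝓝[>] 0) (𝓝 0)

/-- `V = D_*X_t`, that is, `h⁻¹ E[X_t - X_{t-h} | fut_t] → V` in `L²` as `h → 0+`. -/
def HasBackwardDeriv (X : ℝ → Ω → E) (t : ℝ) (V : Ω → E) : Prop :=
  MemLp V 2 P ∧
    Tendsto (fun h : ℝ =>
        eLpNorm (h⁻¹ • condExp (fut (OrderDual.toDual t)) P (X t - X (t - h)) - V) 2 P)
      (𝓝[>] 0) (𝓝 0)

/-- Continuity of `t ↦ V t` from the open interval `I` to `L²`. -/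
def L2ContinuousOn (V : ℝ → Ω → E) : Prop :=
  ∀ t ∈ Ioo a b, Tendsto (fun s => eLpNorm (V s - V t) 2 P) (𝓝[Ioo a b] t) (𝓝 0)

/-- S1-processes: S0-processes for which `DX_t` and `D_*X_t` exist in `L²` for all `t ∈ I` and
depend continuously on `t`. -/
structure IsS1 (X : ℝ → Ω → E) : Prop where
  isS0 : IsS0 P past fut a b X
  forward : ∃ V : ℝ → Ω → E,
    (∀ t ∈ Ioo a b, HasForwardDeriv P past X t (V t)) ∧ L2ContinuousOn P a b V
  backward : ∃ V : ℝ → Ω → E,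
    (∀ t ∈ Ioo a b, HasBackwardDeriv P fut X t (V t)) ∧ L2ContinuousOn P a b V

open Classical in
/-- The process `DX` on `I`. The random variables `DX_t` are defined up to null sets; a jointly
measurable version is taken, so that integrals over time make sense. -/
def fwd (X : ℝ → Ω → E) : ℝ → Ω → E :=
  if h : ∃ V : ℝ → Ω → E, StronglyMeasurable (Function.uncurry V) ∧
      ∀ t ∈ Ioo a b, HasForwardDeriv P past X t (V t)
  then h.choose else 0

open Classical in
/-- The process `D_*X` on `I`, again in a jointly measurable version. -/
def bwd (X : ℝ → Ω → E) : ℝ → Ω → E :=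
  if h : ∃ V : ℝ → Ω → E, StronglyMeasurable (Function.uncurry V) ∧
      ∀ t ∈ Ioo a b, HasBackwardDeriv P fut X t (V t)
  then h.choose else 0

/-- `sup_{t ∈ I} (‖X_t‖ + ‖DX_t‖ + ‖D_*X_t‖)` (norms in `L²`), in `[0, ∞]`. -/
def c1Norm (X : ℝ → Ω → E) : ℝ≥0∞ :=
  ⨆ t ∈ Ioo a b, (eLpNorm (X t) 2 P + eLpNorm (fwd P past a b X t) 2 P
    + eLpNorm (bwd P fut a b X t) 2 P)

/-- The normed space `C¹(I)`: S1-processes of finite norm. For `E = ℝ^d` this is `C¹(I)`, for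
`E = ℂ^d` it is `C¹_ℂ(I)`. -/
def C1 : Set (ℝ → Ω → E) :=
  {X | IsS1 P past fut a b X ∧ c1Norm P past fut a b X < ⊤}

/-- A process given on the open interval `I`, up to null sets for each time, belongs to
`C¹(I)`: it has a version which is a process of that space. -/
def HasC1Version (Y : ℝ → Ω → E) : Prop :=
  ∃ Z ∈ C1 P past fut a b (E := E), ∀ t ∈ Ioo a b, Y t =ᵐ[P] Z t

/-- The spaces `C^n(I)`: all iterated derivatives by `D` and `D_*` of order less than `n` are
processes in `C¹(I)`. -/
def Cn : ℕ → Set (ℝ → Ω → E)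
  | 0 => {X | IsS0 P past fut a b X}
  | 1 => C1 P past fut a b
  | n + 2 => {X | X ∈ C1 P past fut a b ∧
      (∃ Y ∈ Cn (n + 1), ∀ t ∈ Ioo a b, HasForwardDeriv P past X t (Y t)) ∧
      (∃ Y ∈ Cn (n + 1), ∀ t ∈ Ioo a b, HasBackwardDeriv P fut X t (Y t))}

end Processes

section Nelson

variable {Ω : Type*} {m0 : MeasurableSpace Ω} (P : Measure Ω)
  (past : Filtration ℝ m0) (fut : Filtration ℝᵒᵈ m0) (a b : ℝ) {d : ℕ} (μ : ℝ)

/-- `(u + w) / 2 + i μ (u - w) / 2`. -/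
def combine (u w : CVec d) : CVec d :=
  (1 / 2 : ℂ) • (u + w) + (Complex.I * (μ : ℂ) / 2) • (u - w)

/-- `𝒟_μ X = (DX + D_*X) / 2 + i μ (DX - D_*X) / 2` for a real process `X`. -/
def nelson (X : ℝ → Ω → RVec d) : ℝ → Ω → CVec d := fun t ω =>
  combine μ (toC (fwd P past a b X t ω)) (toC (bwd P fut a b X t ω))

/-- `𝒟_μ`, by the same formula, for a complex process. -/
def nelsonC (Y : ℝ → Ω → CVec d) : ℝ → Ω → CVec d := fun t ω =>
  combine μ (fwd P past a b Y t ω) (bwd P fut a b Y t ω)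

end Nelson

section Lagrangian

variable {d : ℕ} (L : RVec d → CVec d → ℂ)

/-- Admissible (autonomous) Lagrangians `L(x, v)`: holomorphic in the second variable. -/
def Admissible : Prop := ∀ x, Differentiable ℂ (L x)

/-- `L` is twice differentiable on `ℝ^d × ℂ^d` (in the real sense), and its second derivatives
are bounded. -/
def BoundedSecondDerivs : Prop :=
  Differentiable ℝ (Function.uncurry L) ∧
  Differentiable ℝ (fderiv ℝ (Function.uncurry L)) ∧
  ∃ K : ℝ, ∀ p, ‖fderiv ℝ (fderiv ℝ (Function.uncurry L)) p‖ ≤ K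

/-- `∂_x L = (∂L/∂x_1, …, ∂L/∂x_d)`. -/
def dx (x : RVec d) (v : CVec d) : CVec d :=
  WithLp.toLp 2 (fun k => fderiv ℝ (fun y => L y v) x (EuclideanSpace.single k 1))

/-- `∂_v L = (∂L/∂v_1, …, ∂L/∂v_d)` (complex derivatives). -/
def dv (x : RVec d) (v : CVec d) : CVec d :=
  WithLp.toLp 2 (fun k => fderiv ℂ (fun w => L x w) v (EuclideanSpace.single k 1))

end Lagrangian

section Variational

variable {Ω : Type*} {m0 : MeasurableSpace Ω} (P : Measure Ω)
  (past : Filtration ℝ m0) (fut : Filtration ℝᵒᵈ m0) (a b : ℝ) {d : ℕ} (μ : ℝ)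
  (L : RVec d → CVec d → ℂ)

/-- The process `∂_x L(X, 𝒟_μ X)`. -/
def dxAlong (X : ℝ → Ω → RVec d) : ℝ → Ω → CVec d := fun t ω =>
  dx L (X t ω) (nelson P past fut a b μ X t ω)

/-- The process `∂_v L(X, 𝒟_μ X)`. -/
def dvAlong (X : ℝ → Ω → RVec d) : ℝ → Ω → CVec d := fun t ω =>
  dv L (X t ω) (nelson P past fut a b μ X t ω)

/-- The domain `Ξ` of the functional: `X ∈ C¹(I)` with `E ∫_I |L(X, 𝒟_μ X)| dt < ∞`. -/
def Xi : Set (ℝ → Ω → RVec d) :=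
  {X | X ∈ C1 P past fut a b ∧
    ∫⁻ ω, (∫⁻ t in Ioo a b, ‖L (X t ω) (nelson P past fut a b μ X t ω)‖ₑ) ∂P < ⊤}

/-- The functional `F_I(X) = E ∫_I L(X, 𝒟_μ X) dt`. -/
def functional (X : ℝ → Ω → RVec d) : ℂ :=
  ∫ ω, (∫ t in Ioo a b, L (X t ω) (nelson P past fut a b μ X t ω)) ∂P

/-- The set `𝓛` of `L`-adapted processes. -/
def LAdapted : Set (ℝ → Ω → RVec d) :=
  {X | X ∈ C1 P past fut a b ∧
    (∀ t ∈ Ioo a b,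
      AEStronglyMeasurable[past t] (dxAlong P past fut a b μ L X t) P ∧
      AEStronglyMeasurable[fut (OrderDual.toDual t)] (dxAlong P past fut a b μ L X t) P ∧
      MemLp (dxAlong P past fut a b μ L X t) 2 P) ∧
    HasC1Version P past fut a b (dvAlong P past fut a b μ L X)}

/-- `Γ_Ξ = {Z ∈ Γ : X + Z ∈ Ξ for all X ∈ Ξ}`. -/
def admissibleVariations (Γ : Set (ℝ → Ω → RVec d)) : Set (ℝ → Ω → RVec d) :=
  {Z | Z ∈ Γ ∧ ∀ X ∈ Xi P past fut a b μ L, Z + X ∈ Xi P past fut a b μ L}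

/-- `dF` is the `Γ`-differential of `F_I` at `X`: it is linear on `Γ_Ξ`, and
`F_I(X + Z) - F_I(X) = dF(Z) + o(‖Z‖)` for `Z ∈ Γ_Ξ`. -/
def IsDifferentialAt (Γ : Set (ℝ → Ω → RVec d)) (X : ℝ → Ω → RVec d)
    (dF : (ℝ → Ω → RVec d) → ℂ) : Prop :=
  (∀ Z ∈ admissibleVariations P past fut a b μ L Γ,
    ∀ W ∈ admissibleVariations P past fut a b μ L Γ, ∀ r s : ℝ,
      dF (r • Z + s • W) = r * dF Z + s * dF W) ∧
  ∀ ε : ℝ, 0 < ε → ∃ δ : ℝ, 0 < δ ∧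
    ∀ Z ∈ admissibleVariations P past fut a b μ L Γ,
      (c1Norm P past fut a b Z).toReal ≤ δ →
        ‖functional P past fut a b μ L (X + Z) - functional P past fut a b μ L X - dF Z‖
          ≤ ε * (c1Norm P past fut a b Z).toReal

/-- `X` is a `Γ`-critical process of `F_I`: `X ∈ Ξ ∩ 𝓛`, `F_I` is `Γ`-differentiable at `X`, and
the differential vanishes on all `Z ∈ Γ_Ξ` with `Z(a) = Z(b) = 0`. -/
def IsCritical (Γ : Set (ℝ → Ω → RVec d)) (X : ℝ → Ω → RVec d) : Prop :=
  X ∈ Xi P past fut a b μ L ∧ X ∈ LAdapted P past fut a b μ L ∧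
  ∃ dF : (ℝ → Ω → RVec d) → ℂ, IsDifferentialAt P past fut a b μ L Γ X dF ∧
    ∀ Z ∈ admissibleVariations P past fut a b μ L Γ,
      Z a =ᵐ[P] 0 → Z b =ᵐ[P] 0 → dF Z = 0

/-- The Euler–Lagrange equation `∂_x L(X, 𝒟_μ X) - 𝒟_{-μ}[∂_v L(X, 𝒟_μ X)] = 0` on `I`. -/
def EulerLagrange (X : ℝ → Ω → RVec d) : Prop :=
  ∀ t ∈ Ioo a b, ∀ᵐ ω ∂P,
    dxAlong P past fut a b μ L X t ω
      - nelsonC P past fut a b (-μ) (dvAlong P past fut a b μ L X) t ω = 0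

end Variational

end StochCV

end

/-! Bounded second derivatives give `L` at most quadratic growth, so every process of `C1` lies in
`Xi` and every element of `C1` is an admissible variation. Taylor's formula then shows that
`firstVariation` is a differential of the functional at `X`, with an error of order ‖Z‖²; by
homogeneity it is the only one on `C1` (`IsDifferentialAt.unique`).

The engine is Nelson's product rule d/dt E[X_t Y_t] = E[DX_t Y_t] + E[X_t D_*Y_t]. Split the
increment as (X_{t+h} - X_t) Y_t + X_{t+h} (Y_{t+h} - Y_t). Here Y_t is measurable for the past at t
and X_{t+h} for the future at t + h, so the conditional expectations in D and D_* can be inserted at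
no cost. Integrated over I, the rule moves D to the other factor as -D_*, and D_* as -D. Since 𝒟_μ =
c_μ D + c_{-μ} D_* with c_μ = (1 + iμ)/2, the operator 𝒟_μ becomes -𝒟_{-μ}. For Z vanishing at the
end points the first variation is therefore ∫ E[W_t · Z_t] dt, where W is the left side of (EL)
(`firstVariation_eq_integral`). So (EL) implies criticality.

For the converse, W itself has to serve as a test process, so it must be of class C¹. This is where
holomorphy enters. The increments of the first derivatives of `L` are entire in v and bounded, hence
constant in v by Liouville's theorem. Consequently the second derivatives with one slot in a
v-direction are constant, and ∂_v L is affine in (x, v) (`exists_dv_eq`). Then 𝒟_{-μ}[∂_v L] is a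
real-linear expression in first and second order Nelson derivatives of X, which is C¹ when X is C³.
Testing with φ Re W and φ Im W, φ(t) = (t - a)(b - t), gives ∫ φ E|W|² = 0, and continuity of
E|W_t|² forces W_t = 0 almost surely at every time. -/

set_option linter.unusedSectionVars false

noncomputable section

namespace StochCV

/-! ### Convergence in `L²` of families of random variables. -/

section TendstoL2

variable {Ω ι : Type*} {m0 : MeasurableSpace Ω} {P : Measure Ω} {l : Filter ι}
  {E F : Type*} [NormedAddCommGroup E] [NormedSpace ℝ E]
  [NormedAddCommGroup F] [NormedSpace ℝ F]

/-- Convergence in `L²` of a family of random variables. -/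
def TendstoL2 (P : Measure Ω) (l : Filter ι) (f : ι → Ω → E) (g : Ω → E) : Prop :=
  Tendsto (fun i => eLpNorm (f i - g) 2 P) l (𝓝 0)

theorem eLpNorm_clm_comp_le (T : E →L[ℝ] F) (f : Ω → E) :
    eLpNorm (fun ω => T (f ω)) 2 P ≤ ENNReal.ofReal ‖T‖ * eLpNorm f 2 P :=
  eLpNorm_le_mul_eLpNorm_of_ae_le_mul (ae_of_all _ fun ω => T.le_opNorm (f ω)) 2

theorem TendstoL2.congr {f f' : ι → Ω → E} {g g' : Ω → E} (h : TendstoL2 P l f g)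
    (hf : ∀ᶠ i in l, f i =ᵐ[P] f' i) (hg : g =ᵐ[P] g') : TendstoL2 P l f' g' := by
  refine Tendsto.congr' ?_ h
  filter_upwards [hf] with i hi
  exact eLpNorm_congr_ae (hi.sub hg)

theorem TendstoL2.add {f f' : ι → Ω → E} {g g' : Ω → E} (h : TendstoL2 P l f g)
    (h' : TendstoL2 P l f' g') (hf : ∀ᶠ i in l, AEStronglyMeasurable (f i) P)
    (hf' : ∀ᶠ i in l, AEStronglyMeasurable (f' i) P) (hg : AEStronglyMeasurable g P)
    (hg' : AEStronglyMeasurable g' P) :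
    TendstoL2 P l (fun i => f i + f' i) (g + g') := by
  have h0 := Tendsto.add h h'
  rw [add_zero] at h0
  refine tendsto_of_tendsto_of_tendsto_of_le_of_le' tendsto_const_nhds h0
    (Eventually.of_forall fun _ => zero_le) ?_
  filter_upwards [hf, hf'] with i hi hi'
  rw [add_sub_add_comm]
  exact eLpNorm_add_le (hi.sub hg) (hi'.sub hg') (by norm_num)

theorem TendstoL2.clm {f : ι → Ω → E} {g : Ω → E} (h : TendstoL2 P l f g) (T : E →L[ℝ] F) :
    TendstoL2 P l (fun i ω => T (f i ω)) (fun ω => T (g ω)) := by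
  have h0 := ENNReal.Tendsto.const_mul (a := ENNReal.ofReal ‖T‖) h
    (Or.inr ENNReal.ofReal_ne_top)
  rw [mul_zero] at h0
  refine tendsto_of_tendsto_of_tendsto_of_le_of_le tendsto_const_nhds h0
    (fun _ => zero_le) fun i => ?_
  refine le_trans (le_of_eq ?_) (eLpNorm_clm_comp_le T (f i - g))
  congr 1
  ext ω
  simp

theorem TendstoL2.smul {f : ι → Ω → E} {g : Ω → E} {c : ι → ℝ} {c0 : ℝ}
    (h : TendstoL2 P l f g) (hc : Tendsto c l (𝓝 c0))
    (hf : ∀ᶠ i in l, AEStronglyMeasurable (f i) P) (hg : MemLp g 2 P) :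
    TendstoL2 P l (fun i => c i • f i) (c0 • g) := by
  have h1 : Tendsto (fun i => ‖c i‖ₑ * eLpNorm (f i - g) 2 P) l (𝓝 (‖c0‖ₑ * 0)) :=
    ENNReal.Tendsto.mul (continuous_enorm.tendsto _ |>.comp hc) (Or.inr ENNReal.zero_ne_top) h
      (Or.inr (enorm_ne_top))
  have h2 : Tendsto (fun i => ‖c i - c0‖ₑ * eLpNorm g 2 P) l (𝓝 (‖(0 : ℝ)‖ₑ * eLpNorm g 2 P)) := by
    refine ENNReal.Tendsto.mul_const ?_ (Or.inr hg.eLpNorm_ne_top)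
    refine (continuous_enorm.tendsto _).comp ?_
    simpa using hc.sub_const c0
  have h0 := h1.add h2
  simp only [mul_zero, enorm_zero, zero_mul, add_zero] at h0
  refine tendsto_of_tendsto_of_tendsto_of_le_of_le' tendsto_const_nhds h0
    (Eventually.of_forall fun _ => zero_le) ?_
  filter_upwards [hf] with i hi
  have e : c i • f i - c0 • g = c i • (f i - g) + (c i - c0) • g := by
    rw [smul_sub, sub_smul]; abel
  rw [e, ← eLpNorm_const_smul, ← eLpNorm_const_smul]
  exact eLpNorm_add_le ((hi.sub hg.1).const_smul _) (hg.1.const_smul _) (by norm_num)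

theorem TendstoL2.comp {κ : Type*} {l' : Filter κ} {f : ι → Ω → E} {g : Ω → E}
    (h : TendstoL2 P l f g) {u : κ → ι} (hu : Tendsto u l' l) :
    TendstoL2 P l' (fun i => f (u i)) g :=
  Tendsto.comp (g := fun i => eLpNorm (f i - g) 2 P) h hu

theorem TendstoL2.unique [l.NeBot] {f : ι → Ω → E} {g g' : Ω → E} (h : TendstoL2 P l f g)
    (h' : TendstoL2 P l f g') (hf : ∀ᶠ i in l, AEStronglyMeasurable (f i) P)
    (hg : AEStronglyMeasurable g P) (hg' : AEStronglyMeasurable g' P) : g =ᵐ[P] g' := by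
  have h0 := Tendsto.add h h'
  rw [add_zero] at h0
  have h1 : eLpNorm (g - g') 2 P ≤ 0 := by
    refine ge_of_tendsto h0 ?_
    filter_upwards [hf] with i hi
    have e : g - g' = -(f i - g) + (f i - g') := by abel
    rw [e, ← eLpNorm_neg (f i - g)]
    exact eLpNorm_add_le (hi.sub hg).neg (hi.sub hg') (by norm_num)
  have h2 := (eLpNorm_eq_zero_iff (hg.sub hg') (by norm_num)).1 (le_antisymm h1 zero_le)
  filter_upwards [h2] with ω hω
  exact sub_eq_zero.1 hω

/-- Once the distance to `g` is below 1 it is finite. This supplies square integrability of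
difference quotients of conditional expectations from their convergence alone. -/
theorem TendstoL2.eventually_memLp {f : ι → Ω → E} {g : Ω → E} (h : TendstoL2 P l f g)
    (hf : ∀ᶠ i in l, AEStronglyMeasurable (f i) P) (hg : MemLp g 2 P) :
    ∀ᶠ i in l, MemLp (f i) 2 P := by
  filter_upwards [hf, Tendsto.eventually_lt_const (u := 1) (by norm_num) h] with i hi hi'
  have : MemLp (f i - g) 2 P := ⟨hi.sub hg.1, hi'.trans ENNReal.one_lt_top⟩
  simpa using this.add hg

/-- Convergence in `L²` implies convergence of the corresponding elements of `Lp`. -/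
theorem TendstoL2.tendsto_toLp {f : ι → Ω → E} {g : Ω → E} (h : TendstoL2 P l f g)
    {u : ι → Lp E 2 P} {v : Lp E 2 P} (hu : ∀ᶠ i in l, u i =ᵐ[P] f i) (hv : v =ᵐ[P] g) :
    Tendsto u l (𝓝 v) := by
  rw [Lp.tendsto_Lp_iff_tendsto_eLpNorm']
  refine Tendsto.congr' ?_ h
  filter_upwards [hu] with i hi
  exact eLpNorm_congr_ae (hi.sub hv).symm

end TendstoL2

/-! ### Calculus of conditional difference quotients, common to D and D_*. -/

section CondDeriv

variable {Ω : Type*} {m m0 : MeasurableSpace Ω} {P : Measure Ω}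
  {E F : Type*} [NormedAddCommGroup E] [NormedSpace ℝ E] [CompleteSpace E]
  [NormedAddCommGroup F] [NormedSpace ℝ F] [CompleteSpace F]

/-- `h⁻¹ E[Δ h | m] → V` in `L²` as `h → 0+`. -/
def HasCondDeriv (P : Measure Ω) (m : MeasurableSpace Ω) (Δ : ℝ → Ω → E) (V : Ω → E) : Prop :=
  MemLp V 2 P ∧ TendstoL2 P (𝓝[>] 0) (fun h : ℝ => h⁻¹ • condExp m P (Δ h)) V

theorem aestronglyMeasurable_quotient (f : Ω → E) (h : ℝ) :
    AEStronglyMeasurable (h⁻¹ • condExp m P f) P :=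
  integrable_condExp.aestronglyMeasurable.const_smul _

theorem HasCondDeriv.unique {Δ : ℝ → Ω → E} {V W : Ω → E} (hV : HasCondDeriv P m Δ V)
    (hW : HasCondDeriv P m Δ W) : V =ᵐ[P] W :=
  hV.2.unique hW.2 (Eventually.of_forall fun _ => aestronglyMeasurable_quotient _ _) hV.1.1 hW.1.1

theorem HasCondDeriv.congr {Δ Δ' : ℝ → Ω → E} {V W : Ω → E} (hV : HasCondDeriv P m Δ V)
    (hΔ : ∀ᶠ h in 𝓝[>] 0, Δ h =ᵐ[P] Δ' h) (hVW : V =ᵐ[P] W) : HasCondDeriv P m Δ' W := by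
  refine ⟨hV.1.ae_eq hVW, hV.2.congr ?_ hVW⟩
  filter_upwards [hΔ] with h hh
  exact (condExp_congr_ae hh).const_smul _

theorem HasCondDeriv.add {Δ Δ' : ℝ → Ω → E} {V W : Ω → E} (hV : HasCondDeriv P m Δ V)
    (hW : HasCondDeriv P m Δ' W) (hΔ : ∀ᶠ h in 𝓝[>] 0, Integrable (Δ h) P)
    (hΔ' : ∀ᶠ h in 𝓝[>] 0, Integrable (Δ' h) P) :
    HasCondDeriv P m (fun h => Δ h + Δ' h) (V + W) := by
  refine ⟨hV.1.add hW.1, (hV.2.add hW.2 (Eventually.of_forall fun _ =>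
    aestronglyMeasurable_quotient _ _) (Eventually.of_forall fun _ =>
    aestronglyMeasurable_quotient _ _) hV.1.1 hW.1.1).congr ?_ .rfl⟩
  filter_upwards [hΔ, hΔ'] with h hh hh'
  filter_upwards [condExp_add hh hh' m] with ω hω
  simp only [Pi.smul_apply, Pi.add_apply] at hω ⊢
  rw [hω, smul_add]

theorem HasCondDeriv.clm {Δ : ℝ → Ω → E} {V : Ω → E} (hV : HasCondDeriv P m Δ V)
    (hΔ : ∀ᶠ h in 𝓝[>] 0, Integrable (Δ h) P) (T : E →L[ℝ] F) :
    HasCondDeriv P m (fun h ω => T (Δ h ω)) (fun ω => T (V ω)) := by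
  refine ⟨T.comp_memLp' hV.1, (hV.2.clm T).congr ?_ .rfl⟩
  filter_upwards [hΔ] with h hh
  filter_upwards [T.comp_condExp_comm (m := m) hh] with ω hω
  simp only [Pi.smul_apply, map_smul, Function.comp_apply] at hω ⊢
  rw [hω]
  rfl

theorem HasCondDeriv.smul {Δ : ℝ → Ω → E} {V : Ω → E} (hV : HasCondDeriv P m Δ V)
    {c : ℝ → ℝ} {c0 : ℝ} (hc : Tendsto c (𝓝[>] 0) (𝓝 c0)) :
    HasCondDeriv P m (fun h => c h • Δ h) (c0 • V) := by
  refine ⟨hV.1.const_smul _, (hV.2.smul hc (Eventually.of_forall fun _ =>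
    aestronglyMeasurable_quotient _ _) hV.1).congr (Eventually.of_forall fun h => ?_) .rfl⟩
  filter_upwards [condExp_smul (μ := P) (c h) (Δ h) m] with ω hω
  simp only [Pi.smul_apply] at hω ⊢
  rw [hω, smul_comm]

/-- Conditioning does not change `W`, so only the scalar quotient has to converge. This is the term
of the product rule in which the time factor is differentiated. -/
theorem HasCondDeriv.const_smul_of_measurable [IsFiniteMeasure P] (hm : m ≤ m0) {W : Ω → E}
    (hW : StronglyMeasurable[m] W) (hW2 : MemLp W 2 P) {k : ℝ → ℝ} {k0 : ℝ}
    (hk : Tendsto (fun h => h⁻¹ * k h) (𝓝[>] 0) (𝓝 k0)) :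
    HasCondDeriv P m (fun h => k h • W) (k0 • W) := by
  refine ⟨hW2.const_smul _, ?_⟩
  have h1 : TendstoL2 P (𝓝[>] (0 : ℝ)) (fun _ => W) W := by
    simp only [TendstoL2, sub_self, eLpNorm_zero]
    exact tendsto_const_nhds
  refine (h1.smul hk (Eventually.of_forall fun _ => hW2.1) hW2).congr
    (Eventually.of_forall fun h => ?_) .rfl
  rw [condExp_of_stronglyMeasurable hm (hW.const_smul _)
    ((hW2.integrable (by norm_num)).smul _), smul_smul]

end CondDeriv

/-! ### S1-processes with bounded derivatives, and operations on them. -/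

section C1Derivs

variable {Ω : Type*} {m0 : MeasurableSpace Ω} {P : Measure Ω} [IsFiniteMeasure P]
  {past : Filtration ℝ m0} {fut : Filtration ℝᵒᵈ m0} {a b : ℝ}
  {E F : Type*} [NormedAddCommGroup E] [NormedSpace ℝ E] [CompleteSpace E]
  [NormedAddCommGroup F] [NormedSpace ℝ F] [CompleteSpace F]

theorem hasForwardDeriv_iff {X : ℝ → Ω → E} {t : ℝ} {V : Ω → E} :
    HasForwardDeriv P past X t V ↔ HasCondDeriv P (past t) (fun h => X (t + h) - X t) V :=
  Iff.rfl

theorem hasBackwardDeriv_iff {X : ℝ → Ω → E} {t : ℝ} {V : Ω → E} :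
    HasBackwardDeriv P fut X t V ↔
      HasCondDeriv P (fut (OrderDual.toDual t)) (fun h => X t - X (t - h)) V :=
  Iff.rfl

theorem eventually_add_mem_Ioo {t : ℝ} (ht : t ∈ Ioo a b) :
    ∀ᶠ h : ℝ in 𝓝[>] 0, t + h ∈ Ioo a b := by
  refine eventually_nhdsWithin_of_eventually_nhds ?_
  exact (Continuous.tendsto' (by fun_prop : Continuous fun h : ℝ => t + h) 0 t
    (by simp)).eventually (isOpen_Ioo.mem_nhds ht)

theorem eventually_sub_mem_Ioo {t : ℝ} (ht : t ∈ Ioo a b) :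
    ∀ᶠ h : ℝ in 𝓝[>] 0, t - h ∈ Ioo a b := by
  refine eventually_nhdsWithin_of_eventually_nhds ?_
  exact (Continuous.tendsto' (by fun_prop : Continuous fun h : ℝ => t - h) 0 t
    (by simp)).eventually (isOpen_Ioo.mem_nhds ht)

/-- For small `h` the quotient sees only times inside the open interval. Hence derivatives may be
computed on a version of a process. -/
theorem HasForwardDeriv.congr_process {X Y : ℝ → Ω → E} {t : ℝ} {V : Ω → E} (ht : t ∈ Ioo a b)
    (h : HasForwardDeriv P past X t V) (hXY : ∀ s ∈ Ioo a b, X s =ᵐ[P] Y s) :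
    HasForwardDeriv P past Y t V := by
  rw [hasForwardDeriv_iff] at h ⊢
  refine h.congr ?_ .rfl
  filter_upwards [eventually_add_mem_Ioo ht] with s hs
  exact (hXY _ hs).sub (hXY _ ht)

theorem HasBackwardDeriv.congr_process {X Y : ℝ → Ω → E} {t : ℝ} {V : Ω → E} (ht : t ∈ Ioo a b)
    (h : HasBackwardDeriv P fut X t V) (hXY : ∀ s ∈ Ioo a b, X s =ᵐ[P] Y s) :
    HasBackwardDeriv P fut Y t V := by
  rw [hasBackwardDeriv_iff] at h ⊢
  refine h.congr ?_ .rfl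
  filter_upwards [eventually_sub_mem_Ioo ht] with s hs
  exact (hXY _ ht).sub (hXY _ hs)

theorem HasForwardDeriv.congr_deriv {X : ℝ → Ω → E} {t : ℝ} {V W : Ω → E}
    (h : HasForwardDeriv P past X t V) (hVW : V =ᵐ[P] W) : HasForwardDeriv P past X t W :=
  HasCondDeriv.congr (Δ := fun h => X (t + h) - X t) h (Eventually.of_forall fun _ => .rfl) hVW

theorem HasBackwardDeriv.congr_deriv {X : ℝ → Ω → E} {t : ℝ} {V W : Ω → E}
    (h : HasBackwardDeriv P fut X t V) (hVW : V =ᵐ[P] W) : HasBackwardDeriv P fut X t W :=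
  HasCondDeriv.congr (Δ := fun h => X t - X (t - h)) h (Eventually.of_forall fun _ => .rfl) hVW

theorem IsS0.memLp_Ioo {X : ℝ → Ω → E} (hX : IsS0 P past fut a b X) {t : ℝ} (ht : t ∈ Ioo a b) :
    MemLp (X t) 2 P :=
  hX.memLp t (Ioo_subset_Icc_self ht)

theorem IsS0.integrable_forward {X : ℝ → Ω → E} (hX : IsS0 P past fut a b X) {t : ℝ}
    (ht : t ∈ Ioo a b) : ∀ᶠ h : ℝ in 𝓝[>] 0, Integrable (X (t + h) - X t) P := by
  filter_upwards [eventually_add_mem_Ioo ht] with s hs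
  exact ((hX.memLp_Ioo hs).sub (hX.memLp_Ioo ht)).integrable (by norm_num)

theorem IsS0.integrable_backward {X : ℝ → Ω → E} (hX : IsS0 P past fut a b X) {t : ℝ}
    (ht : t ∈ Ioo a b) : ∀ᶠ h : ℝ in 𝓝[>] 0, Integrable (X t - X (t - h)) P := by
  filter_upwards [eventually_sub_mem_Ioo ht] with s hs
  exact ((hX.memLp_Ioo ht).sub (hX.memLp_Ioo hs)).integrable (by norm_num)

theorem IsS0.add {X Y : ℝ → Ω → E} (hX : IsS0 P past fut a b X) (hY : IsS0 P past fut a b Y) :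
    IsS0 P past fut a b (X + Y) where
  continuous_paths := by
    filter_upwards [hX.continuous_paths, hY.continuous_paths] with ω h h'
    exact h.add h'
  adapted_past t ht := (hX.adapted_past t ht).add (hY.adapted_past t ht)
  adapted_fut t ht := (hX.adapted_fut t ht).add (hY.adapted_fut t ht)
  memLp t ht := (hX.memLp t ht).add (hY.memLp t ht)
  continuous_L2 t ht :=
    TendstoL2.add (hX.continuous_L2 t ht) (hY.continuous_L2 t ht)
      (eventually_nhdsWithin_of_forall fun s hs => (hX.memLp s hs).1)
      (eventually_nhdsWithin_of_forall fun s hs => (hY.memLp s hs).1)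
      (hX.memLp t ht).1 (hY.memLp t ht).1

theorem IsS0.clm {X : ℝ → Ω → E} (hX : IsS0 P past fut a b X) (T : E →L[ℝ] F) :
    IsS0 P past fut a b (fun t ω => T (X t ω)) where
  continuous_paths := by
    filter_upwards [hX.continuous_paths] with ω h
    exact T.continuous.comp_continuousOn h
  adapted_past t ht := T.continuous.comp_stronglyMeasurable (hX.adapted_past t ht)
  adapted_fut t ht := T.continuous.comp_stronglyMeasurable (hX.adapted_fut t ht)
  memLp t ht := T.comp_memLp' (hX.memLp t ht)
  continuous_L2 t ht := TendstoL2.clm (f := X) (hX.continuous_L2 t ht) T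

theorem IsS0.smul_fun {X : ℝ → Ω → E} (hX : IsS0 P past fut a b X) {φ : ℝ → ℝ}
    (hφ : Continuous φ) : IsS0 P past fut a b (fun t => φ t • X t) where
  continuous_paths := by
    filter_upwards [hX.continuous_paths] with ω h
    exact hφ.continuousOn.smul h
  adapted_past t ht := (hX.adapted_past t ht).const_smul _
  adapted_fut t ht := (hX.adapted_fut t ht).const_smul _
  memLp t ht := (hX.memLp t ht).const_smul _
  continuous_L2 t ht :=
    TendstoL2.smul (hX.continuous_L2 t ht) (hφ.continuousWithinAt)
      (eventually_nhdsWithin_of_forall fun s hs => (hX.memLp s hs).1) (hX.memLp t ht)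

theorem isS0_const (c : E) : IsS0 P past fut a b (fun _ _ => c) where
  continuous_paths := ae_of_all _ fun _ => continuousOn_const
  adapted_past _ _ := stronglyMeasurable_const
  adapted_fut _ _ := stronglyMeasurable_const
  memLp _ _ := memLp_const c
  continuous_L2 _ _ := by simpa using tendsto_const_nhds

/-- `X` is an S1-process with derivatives `V`, `U`, all bounded in `L²`. -/
structure HasC1Derivs (P : Measure Ω) (past : Filtration ℝ m0) (fut : Filtration ℝᵒᵈ m0)
    (a b : ℝ) (X V U : ℝ → Ω → E) : Prop where
  isS0 : IsS0 P past fut a b X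
  forward : ∀ t ∈ Ioo a b, HasForwardDeriv P past X t (V t)
  backward : ∀ t ∈ Ioo a b, HasBackwardDeriv P fut X t (U t)
  cont_forward : L2ContinuousOn P a b V
  cont_backward : L2ContinuousOn P a b U
  bounded : ∃ M : ℝ≥0∞, M < ⊤ ∧ ∀ t ∈ Ioo a b,
    eLpNorm (X t) 2 P ≤ M ∧ eLpNorm (V t) 2 P ≤ M ∧ eLpNorm (U t) 2 P ≤ M

theorem L2ContinuousOn.congr {V W : ℝ → Ω → E} (hV : L2ContinuousOn P a b V)
    (h : ∀ t ∈ Ioo a b, V t =ᵐ[P] W t) : L2ContinuousOn P a b W := fun t ht =>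
  TendstoL2.congr (hV t ht) (eventually_nhdsWithin_of_forall fun s hs => h s hs) (h t ht)

theorem L2ContinuousOn.add {V W : ℝ → Ω → E} (hV : L2ContinuousOn P a b V)
    (hW : L2ContinuousOn P a b W) (hVm : ∀ t ∈ Ioo a b, MemLp (V t) 2 P)
    (hWm : ∀ t ∈ Ioo a b, MemLp (W t) 2 P) : L2ContinuousOn P a b (V + W) := fun t ht =>
  TendstoL2.add (hV t ht) (hW t ht)
      (eventually_nhdsWithin_of_forall fun s hs => (hVm s hs).1)
      (eventually_nhdsWithin_of_forall fun s hs => (hWm s hs).1) (hVm t ht).1 (hWm t ht).1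

theorem L2ContinuousOn.clm {V : ℝ → Ω → E} (hV : L2ContinuousOn P a b V) (T : E →L[ℝ] F) :
    L2ContinuousOn P a b (fun t ω => T (V t ω)) := fun t ht =>
  TendstoL2.clm (f := V) (hV t ht) T

theorem L2ContinuousOn.smul_fun {V : ℝ → Ω → E} (hV : L2ContinuousOn P a b V)
    (hVm : ∀ t ∈ Ioo a b, MemLp (V t) 2 P) {φ : ℝ → ℝ} (hφ : Continuous φ) :
    L2ContinuousOn P a b (fun t => φ t • V t) := fun t ht =>
  TendstoL2.smul (hV t ht) hφ.continuousWithinAt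
    (eventually_nhdsWithin_of_forall fun s hs => (hVm s hs).1) (hVm t ht)

theorem IsS0.l2ContinuousOn {X : ℝ → Ω → E} (hX : IsS0 P past fut a b X) :
    L2ContinuousOn P a b X := fun t ht =>
  (hX.continuous_L2 t (Ioo_subset_Icc_self ht)).mono_left
    (nhdsWithin_mono _ Ioo_subset_Icc_self)

namespace HasC1Derivs

variable {X V U X' V' U' : ℝ → Ω → E}

theorem memLp_forward (h : HasC1Derivs P past fut a b X V U) :
    ∀ t ∈ Ioo a b, MemLp (V t) 2 P := fun t ht => (h.forward t ht).1

theorem memLp_backward (h : HasC1Derivs P past fut a b X V U) :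
    ∀ t ∈ Ioo a b, MemLp (U t) 2 P := fun t ht => (h.backward t ht).1

theorem congr (h : HasC1Derivs P past fut a b X V U) (hV : ∀ t ∈ Ioo a b, V t =ᵐ[P] V' t)
    (hU : ∀ t ∈ Ioo a b, U t =ᵐ[P] U' t) : HasC1Derivs P past fut a b X V' U' where
  isS0 := h.isS0
  forward t ht := (h.forward t ht).congr_deriv (hV t ht)
  backward t ht := (h.backward t ht).congr_deriv (hU t ht)
  cont_forward := h.cont_forward.congr hV
  cont_backward := h.cont_backward.congr hU
  bounded := by
    obtain ⟨M, hM, hb⟩ := h.bounded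
    refine ⟨M, hM, fun t ht => ?_⟩
    rw [← eLpNorm_congr_ae (hV t ht), ← eLpNorm_congr_ae (hU t ht)]
    exact hb t ht

theorem add (h : HasC1Derivs P past fut a b X V U) (h' : HasC1Derivs P past fut a b X' V' U') :
    HasC1Derivs P past fut a b (X + X') (V + V') (U + U') where
  isS0 := h.isS0.add h'.isS0
  forward t ht := by
    refine (HasCondDeriv.add (h.forward t ht) (h'.forward t ht) (h.isS0.integrable_forward ht)
      (h'.isS0.integrable_forward ht)).congr (Eventually.of_forall fun s => ?_) .rfl
    rw [← add_sub_add_comm]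
    rfl
  backward t ht := by
    refine (HasCondDeriv.add (h.backward t ht) (h'.backward t ht) (h.isS0.integrable_backward ht)
      (h'.isS0.integrable_backward ht)).congr (Eventually.of_forall fun s => ?_) .rfl
    rw [← add_sub_add_comm]
    rfl
  cont_forward := h.cont_forward.add h'.cont_forward h.memLp_forward h'.memLp_forward
  cont_backward := h.cont_backward.add h'.cont_backward h.memLp_backward h'.memLp_backward
  bounded := by
    obtain ⟨M, hM, hb⟩ := h.bounded
    obtain ⟨M', hM', hb'⟩ := h'.bounded
    refine ⟨M + M', ENNReal.add_lt_top.2 ⟨hM, hM'⟩, fun t ht => ?_⟩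
    obtain ⟨h1, h2, h3⟩ := hb t ht
    obtain ⟨h1', h2', h3'⟩ := hb' t ht
    exact ⟨(eLpNorm_add_le (h.isS0.memLp_Ioo ht).1 (h'.isS0.memLp_Ioo ht).1
        (by norm_num)).trans (add_le_add h1 h1'),
      (eLpNorm_add_le (h.memLp_forward t ht).1 (h'.memLp_forward t ht).1
        (by norm_num)).trans (add_le_add h2 h2'),
      (eLpNorm_add_le (h.memLp_backward t ht).1 (h'.memLp_backward t ht).1
        (by norm_num)).trans (add_le_add h3 h3')⟩

/-- Conditional expectation commutes with continuous real-linear maps. Real linearity covers complex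
scalars, real and imaginary parts, and the linear part of ∂_v L. -/
theorem clm (h : HasC1Derivs P past fut a b X V U) (T : E →L[ℝ] F) :
    HasC1Derivs P past fut a b (fun t ω => T (X t ω)) (fun t ω => T (V t ω))
      (fun t ω => T (U t ω)) where
  isS0 := h.isS0.clm T
  forward t ht := by
    refine (HasCondDeriv.clm (h.forward t ht) (h.isS0.integrable_forward ht) T).congr
      (Eventually.of_forall fun s => ae_of_all _ fun ω => ?_) .rfl
    simp
  backward t ht := by
    refine (HasCondDeriv.clm (h.backward t ht) (h.isS0.integrable_backward ht) T).congr
      (Eventually.of_forall fun s => ae_of_all _ fun ω => ?_) .rfl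
    simp
  cont_forward := h.cont_forward.clm T
  cont_backward := h.cont_backward.clm T
  bounded := by
    obtain ⟨M, hM, hb⟩ := h.bounded
    refine ⟨ENNReal.ofReal ‖T‖ * M, ENNReal.mul_lt_top ENNReal.ofReal_lt_top hM, fun t ht => ?_⟩
    obtain ⟨h1, h2, h3⟩ := hb t ht
    exact ⟨(eLpNorm_clm_comp_le T _).trans (by gcongr),
      (eLpNorm_clm_comp_le T _).trans (by gcongr), (eLpNorm_clm_comp_le T _).trans (by gcongr)⟩

theorem const_smul (h : HasC1Derivs P past fut a b X V U) (r : ℝ) :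
    HasC1Derivs P past fut a b (r • X) (r • V) (r • U) :=
  h.clm (r • ContinuousLinearMap.id ℝ E)

/-- The product rule for the product of a process with a smooth function of time. -/
theorem smul_fun (h : HasC1Derivs P past fut a b X V U) {φ φ' : ℝ → ℝ}
    (hφ : ∀ t, HasDerivAt φ (φ' t) t) (hφ' : Continuous φ') :
    HasC1Derivs P past fut a b (fun t => φ t • X t) (fun t => φ t • V t + φ' t • X t)
      (fun t => φ t • U t + φ' t • X t) where
  isS0 := h.isS0.smul_fun (continuous_iff_continuousAt.2 fun t => (hφ t).continuousAt)
  forward t ht := by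
    have hXm := h.isS0.memLp_Ioo ht
    have h0 : Tendsto (fun s : ℝ => φ (t + s)) (𝓝[>] 0) (𝓝 (φ t)) := by
      refine Tendsto.mono_left ?_ nhdsWithin_le_nhds
      exact ((hφ t).continuousAt.tendsto).comp (Continuous.tendsto' (by fun_prop) 0 t (by simp))
    have h1 : Tendsto (fun s : ℝ => s⁻¹ * (φ (t + s) - φ t)) (𝓝[>] 0) (𝓝 (φ' t)) :=
      (hφ t).tendsto_slope_zero_right
    -- The increment is split as φ(t+s)(X_{t+s} - X_t) + (φ(t+s) - φ(t)) X_t, with the random factor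
    -- of the second term measurable for the past at t.
    have h2 := HasCondDeriv.smul (h.forward t ht) h0
    have h3 := HasCondDeriv.const_smul_of_measurable (past.le t)
      (h.isS0.adapted_past t (Ioo_subset_Icc_self ht)) hXm h1
    refine (h2.add h3 ?_ ?_).congr (Eventually.of_forall fun s => ?_) .rfl
    · filter_upwards [h.isS0.integrable_forward ht] with s hs using hs.smul _
    · exact Eventually.of_forall fun s => (hXm.integrable (by norm_num)).smul _
    · refine ae_of_all _ fun ω => ?_
      simp only [Pi.add_apply, Pi.smul_apply, Pi.sub_apply, smul_sub, sub_smul]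
      abel
  backward t ht := by
    have hXm := h.isS0.memLp_Ioo ht
    have h00 : Tendsto (fun s : ℝ => t - s) (𝓝[>] 0) (𝓝 t) :=
      Tendsto.mono_left (Continuous.tendsto' (by fun_prop) 0 t (by simp)) nhdsWithin_le_nhds
    have h0 : Tendsto (fun s : ℝ => φ (t - s)) (𝓝[>] 0) (𝓝 (φ t)) :=
      ((hφ t).continuousAt.tendsto).comp h00
    have h1 : Tendsto (fun s : ℝ => s⁻¹ * (φ t - φ (t - s))) (𝓝[>] 0) (𝓝 (φ' t)) := by
      have hn : Tendsto (fun s : ℝ => -s) (𝓝[>] 0) (𝓝[<] 0) := by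
        simpa using tendsto_neg_nhdsGT (a := (0 : ℝ))
      refine ((hφ t).tendsto_slope_zero_left.comp hn).congr fun s => ?_
      simp only [Function.comp_apply, smul_eq_mul, inv_neg, ← sub_eq_add_neg]
      ring
    -- Now the split is φ(t-s)(X_t - X_{t-s}) + (φ(t) - φ(t-s)) X_t, which again leaves X_t alone,
    -- measurable for the future at t.
    have h2 := HasCondDeriv.smul (h.backward t ht) h0
    have h3 := HasCondDeriv.const_smul_of_measurable (fut.le (OrderDual.toDual t))
      (h.isS0.adapted_fut t (Ioo_subset_Icc_self ht)) hXm h1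
    refine (h2.add h3 ?_ ?_).congr (Eventually.of_forall fun s => ?_) .rfl
    · filter_upwards [h.isS0.integrable_backward ht] with s hs using hs.smul _
    · exact Eventually.of_forall fun s => (hXm.integrable (by norm_num)).smul _
    · refine ae_of_all _ fun ω => ?_
      simp only [Pi.add_apply, Pi.smul_apply, Pi.sub_apply, smul_sub, sub_smul]
      abel
  cont_forward := by
    have hc : Continuous φ := continuous_iff_continuousAt.2 fun t => (hφ t).continuousAt
    exact (h.cont_forward.smul_fun h.memLp_forward hc).add
      (h.isS0.l2ContinuousOn.smul_fun (fun t ht => h.isS0.memLp_Ioo ht) hφ')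
      (fun t ht => (h.memLp_forward t ht).const_smul _)
      (fun t ht => (h.isS0.memLp_Ioo ht).const_smul _)
  cont_backward := by
    have hc : Continuous φ := continuous_iff_continuousAt.2 fun t => (hφ t).continuousAt
    exact (h.cont_backward.smul_fun h.memLp_backward hc).add
      (h.isS0.l2ContinuousOn.smul_fun (fun t ht => h.isS0.memLp_Ioo ht) hφ')
      (fun t ht => (h.memLp_backward t ht).const_smul _)
      (fun t ht => (h.isS0.memLp_Ioo ht).const_smul _)
  bounded := by
    have hc : Continuous φ := continuous_iff_continuousAt.2 fun t => (hφ t).continuousAt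
    obtain ⟨M, hM, hb⟩ := h.bounded
    obtain ⟨c, hcb⟩ := isCompact_Icc.exists_bound_of_continuousOn (s := Icc a b) hc.continuousOn
    obtain ⟨c', hcb'⟩ := isCompact_Icc.exists_bound_of_continuousOn (s := Icc a b) hφ'.continuousOn
    have key : ∀ (c : ℝ) (r : ℝ) (f : Ω → E), ‖r‖ ≤ c → eLpNorm f 2 P ≤ M →
        eLpNorm (r • f) 2 P ≤ ENNReal.ofReal c * M := by
      intro c r f hr hf
      rw [eLpNorm_const_smul, ← ofReal_norm]
      gcongr
    refine ⟨ENNReal.ofReal c * M + ENNReal.ofReal c' * M,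
      ENNReal.add_lt_top.2 ⟨ENNReal.mul_lt_top ENNReal.ofReal_lt_top hM,
        ENNReal.mul_lt_top ENNReal.ofReal_lt_top hM⟩, fun t ht => ?_⟩
    obtain ⟨h1, h2, h3⟩ := hb t ht
    have ht' := Ioo_subset_Icc_self ht
    have hXm := (h.isS0.memLp_Ioo ht).1
    refine ⟨(key c _ _ (hcb t ht') h1).trans le_self_add,
      (eLpNorm_add_le ((h.memLp_forward t ht).1.const_smul _) (hXm.const_smul _)
        (by norm_num)).trans (add_le_add (key c _ _ (hcb t ht') h2) (key c' _ _ (hcb' t ht') h1)),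
      (eLpNorm_add_le ((h.memLp_backward t ht).1.const_smul _) (hXm.const_smul _)
        (by norm_num)).trans (add_le_add (key c _ _ (hcb t ht') h3) (key c' _ _ (hcb' t ht') h1))⟩

end HasC1Derivs

/-- Needed for the constant term of the affine function ∂_v L. -/
theorem hasC1Derivs_const (c : E) :
    HasC1Derivs P past fut a b (fun _ _ => c) (fun _ _ => 0) (fun _ _ => 0) where
  isS0 := isS0_const c
  forward t _ := by
    rw [hasForwardDeriv_iff]
    refine ⟨MemLp.zero', ?_⟩
    have h0 : condExp (past t) P (0 : Ω → E) = 0 := condExp_zero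
    have : ∀ h : ℝ, (h⁻¹ • condExp (past t) P ((fun _ : Ω => c) - fun _ => c)
        : Ω → E) = 0 := by
      intro h
      rw [sub_self, h0, smul_zero]
    simp only [TendstoL2, this]
    have e : ((0 : Ω → E) - fun _ => 0) = 0 := by ext; simp
    simp [e]
  backward t _ := by
    rw [hasBackwardDeriv_iff]
    refine ⟨MemLp.zero', ?_⟩
    have h0 : condExp (fut (OrderDual.toDual t)) P (0 : Ω → E) = 0 := condExp_zero
    have : ∀ h : ℝ, (h⁻¹ • condExp (fut (OrderDual.toDual t)) P ((fun _ : Ω => c) - fun _ => c)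
        : Ω → E) = 0 := by
      intro h
      rw [sub_self, h0, smul_zero]
    simp only [TendstoL2, this]
    have e : ((0 : Ω → E) - fun _ => 0) = 0 := by ext; simp
    simp [e]
  cont_forward _ _ := by simpa using tendsto_const_nhds
  cont_backward _ _ := by simpa using tendsto_const_nhds
  bounded := by
    refine ⟨eLpNorm (fun _ : Ω => c) 2 P, (memLp_const c).eLpNorm_lt_top, fun t _ => ?_⟩
    simp

end C1Derivs

/-! ### Jointly measurable versions of `L²`-continuous families. -/

section JointVersion

variable {Ω : Type*} {m0 : MeasurableSpace Ω} {P : Measure Ω}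
  {E : Type*} [NormedAddCommGroup E] [CompleteSpace E]
  [SecondCountableTopology E]

/-- If `f k` approximates `g` in `L²` up to `2⁻ᵏ`, then `f k → g` almost surely. -/
theorem ae_tendsto_of_eLpNorm_lt_geometric {f : ℕ → Ω → E} {g : Ω → E}
    (hf : ∀ k, AEStronglyMeasurable (f k) P) (hg : AEStronglyMeasurable g P)
    (h : ∀ k, eLpNorm (f k - g) 2 P < 2⁻¹ ^ k) :
    ∀ᵐ ω ∂P, Tendsto (fun k => f k ω) atTop (𝓝 (g ω)) := by
  have hpow : Tendsto (fun k : ℕ => (2⁻¹ : ℝ≥0∞) ^ k) atTop (𝓝 0) :=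
    ENNReal.tendsto_pow_atTop_nhds_zero_of_lt_one (by norm_num)
  have h0 : Tendsto (fun k => eLpNorm (f k - g) 2 P) atTop (𝓝 0) :=
    tendsto_of_tendsto_of_tendsto_of_le_of_le tendsto_const_nhds hpow
      (fun _ => zero_le) fun k => (h k).le
  -- Convergence in measure identifies the limit along a subsequence; the summable Cauchy rates 2⁻ⁱ
  -- + 2⁻ⁱ below make the whole sequence converge almost surely.
  obtain ⟨ns, hns, hsub⟩ := (tendstoInMeasure_of_tendsto_eLpNorm (by norm_num) hf hg
    h0).exists_seq_tendsto_ae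
  have hB : ∑' i : ℕ, ((2⁻¹ : ℝ≥0∞) ^ i + 2⁻¹ ^ i) ≠ ∞ := by
    rw [ENNReal.tsum_add, ENNReal.tsum_geometric]
    simp
  have hc := Lp.ae_tendsto_of_cauchy_eLpNorm (p := 2) hf (by norm_num) hB (by
    intro N n m hn hm
    have e : f n - f m = (f n - g) + -(f m - g) := by abel
    rw [e]
    refine (eLpNorm_add_le ((hf n).sub hg) ((hf m).sub hg).neg (by norm_num)).trans_lt ?_
    rw [eLpNorm_neg]
    exact ENNReal.add_lt_add
      ((h n).trans_le (pow_le_pow_right_of_le_one' (by norm_num) hn))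
      ((h m).trans_le (pow_le_pow_right_of_le_one' (by norm_num) hm)))
  filter_upwards [hsub, hc] with ω h1 ⟨l, h2⟩
  rwa [tendsto_nhds_unique h1 (h2.comp hns.tendsto_atTop)]

/-- A continuous map into `L²` has a jointly measurable version. -/
theorem exists_stronglyMeasurable_uncurry_of_continuous {T : Type*} [TopologicalSpace T]
    [TopologicalSpace.SeparableSpace T] [MeasurableSpace T] [OpensMeasurableSpace T] [Nonempty T]
    {v : T → Lp E 2 P} (hv : Continuous v) :
    ∃ W : T → Ω → E, StronglyMeasurable (Function.uncurry W) ∧ ∀ t, v t =ᵐ[P] W t := by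
  classical
  let q : ℕ → T := TopologicalSpace.denseSeq T
  have hopen : ∀ (s : T) (k : ℕ), IsOpen {t | edist (v s) (v t) < 2⁻¹ ^ k} := fun s k =>
    isOpen_lt (continuous_const.edist hv) continuous_const
  have hex : ∀ (k : ℕ) (t : T), ∃ j, edist (v (q j)) (v t) < 2⁻¹ ^ k := by
    intro k t
    have ho := hopen t k
    obtain ⟨j, hj⟩ := (TopologicalSpace.denseRange_denseSeq T).exists_mem_open ho
      ⟨t, by simpa using ENNReal.pow_pos (by norm_num) k⟩
    exact ⟨j, by rw [edist_comm]; exact hj⟩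
  -- The time `t` is replaced by the first point of a dense sequence at which `v` is 2⁻ᵏ-close to `v
  -- t`. Only countably many random variables are used at each level, so `f k` is jointly
  -- measurable.
  let N : ℕ → T → ℕ := fun k t => Nat.find (hex k t)
  have hN : ∀ k, Measurable (N k) := fun k =>
    measurable_find (hex k) fun j => (hopen (q j) k).measurableSet
  let f : ℕ → T × Ω → E := fun k p => v (q (N k p.1)) p.2
  have hf : ∀ k, StronglyMeasurable (f k) := by
    intro k
    borelize E
    have h1 : Measurable (fun p : ℕ × Ω => v (q p.1) p.2) :=
      measurable_from_prod_countable_right fun j =>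
        (Lp.stronglyMeasurable (v (q j))).measurable
    exact (h1.comp (((hN k).comp measurable_fst).prodMk measurable_snd)).stronglyMeasurable
  have hlim : StronglyMeasurable fun p => limUnder atTop fun k => f k p :=
    StronglyMeasurable.limUnder hf
  refine ⟨fun t ω => limUnder atTop fun k => f k (t, ω), hlim, fun t => ?_⟩
  have := ae_tendsto_of_eLpNorm_lt_geometric (P := P) (f := fun k => v (q (N k t))) (g := v t)
    (fun k => Lp.aestronglyMeasurable _) (Lp.aestronglyMeasurable _) (fun k => by
      rw [← Lp.edist_def]
      exact Nat.find_spec (hex k t))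
  filter_upwards [this] with ω hω
  exact hω.limUnder_eq.symm

end JointVersion

/-! ### Choice of the derivatives `fwd` and `bwd`, and joint measurability. -/

section Processes

variable {Ω : Type*} {m0 : MeasurableSpace Ω} {P : Measure Ω} [IsFiniteMeasure P]
  {past : Filtration ℝ m0} {fut : Filtration ℝᵒᵈ m0} {a b : ℝ}
  {E : Type*} [NormedAddCommGroup E] [NormedSpace ℝ E] [CompleteSpace E]

theorem L2ContinuousOn.continuous_toLp {V : ℝ → Ω → E} (hV : L2ContinuousOn P a b V)
    (hm : ∀ t ∈ Ioo a b, MemLp (V t) 2 P) :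
    Continuous fun t : Ioo a b => (hm t t.2).toLp (V t) := by
  refine continuous_iff_continuousAt.2 fun t => ?_
  refine TendstoL2.tendsto_toLp (f := fun s : Ioo a b => V s) (g := V t) ?_
    (Eventually.of_forall fun s => MemLp.coeFn_toLp _) (MemLp.coeFn_toLp _)
  refine TendstoL2.comp (l := 𝓝[Ioo a b] t.1) (hV t t.2) ?_
  rw [nhdsWithin_eq_map_subtype_coe t.2]
  exact tendsto_map

theorem L2ContinuousOn.exists_stronglyMeasurable [SecondCountableTopology E] {V : ℝ → Ω → E}
    (hV : L2ContinuousOn P a b V) (hm : ∀ t ∈ Ioo a b, MemLp (V t) 2 P) :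
    ∃ W : ℝ → Ω → E, StronglyMeasurable (Function.uncurry W) ∧ ∀ t ∈ Ioo a b, V t =ᵐ[P] W t := by
  classical
  rcases (Ioo a b).eq_empty_or_nonempty with h | ⟨c, hc⟩
  · exact ⟨fun _ _ => 0, stronglyMeasurable_const, by simp [h]⟩
  have : Nonempty (Ioo a b) := ⟨⟨c, hc⟩⟩
  obtain ⟨W, hW, hW'⟩ := exists_stronglyMeasurable_uncurry_of_continuous (hV.continuous_toLp hm)
  -- A measurable retraction onto the interval: times outside it are sent to an arbitrary inner
  -- point.
  let r : ℝ → Ioo a b := fun t => ⟨if t ∈ Ioo a b then t else c, by split_ifs <;> assumption⟩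
  have hr : Measurable r :=
    (Measurable.ite measurableSet_Ioo measurable_id measurable_const).subtype_mk
  refine ⟨fun t => W (r t), ?_, fun t ht => ?_⟩
  · exact hW.comp_measurable ((hr.comp measurable_fst).prodMk measurable_snd)
  · have e : r t = ⟨t, ht⟩ := by simp only [r, if_pos ht]
    simp only [e]
    exact (MemLp.coeFn_toLp _).symm.trans (hW' ⟨t, ht⟩)

/-- `L²`-continuity of the derivative provides a jointly measurable version, so the default value 0
in `fwd` is not taken. -/
theorem fwd_spec_of_exists [SecondCountableTopology E] {X V : ℝ → Ω → E}
    (h : ∀ t ∈ Ioo a b, HasForwardDeriv P past X t (V t)) (hV : L2ContinuousOn P a b V) :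
    StronglyMeasurable (Function.uncurry (fwd P past a b X)) ∧
      ∀ t ∈ Ioo a b, HasForwardDeriv P past X t (fwd P past a b X t) := by
  obtain ⟨W, hW, hW'⟩ := hV.exists_stronglyMeasurable fun t ht => (h t ht).1
  have hex : ∃ V : ℝ → Ω → E, StronglyMeasurable (Function.uncurry V) ∧
      ∀ t ∈ Ioo a b, HasForwardDeriv P past X t (V t) :=
    ⟨W, hW, fun t ht => (h t ht).congr_deriv (hW' t ht)⟩
  rw [fwd, dif_pos hex]
  exact hex.choose_spec

theorem bwd_spec_of_exists [SecondCountableTopology E] {X V : ℝ → Ω → E}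
    (h : ∀ t ∈ Ioo a b, HasBackwardDeriv P fut X t (V t)) (hV : L2ContinuousOn P a b V) :
    StronglyMeasurable (Function.uncurry (bwd P fut a b X)) ∧
      ∀ t ∈ Ioo a b, HasBackwardDeriv P fut X t (bwd P fut a b X t) := by
  obtain ⟨W, hW, hW'⟩ := hV.exists_stronglyMeasurable fun t ht => (h t ht).1
  have hex : ∃ V : ℝ → Ω → E, StronglyMeasurable (Function.uncurry V) ∧
      ∀ t ∈ Ioo a b, HasBackwardDeriv P fut X t (V t) :=
    ⟨W, hW, fun t ht => (h t ht).congr_deriv (hW' t ht)⟩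
  rw [bwd, dif_pos hex]
  exact hex.choose_spec

theorem HasForwardDeriv.unique {X : ℝ → Ω → E} {t : ℝ} {V W : Ω → E}
    (h : HasForwardDeriv P past X t V) (h' : HasForwardDeriv P past X t W) : V =ᵐ[P] W :=
  HasCondDeriv.unique (Δ := fun h => X (t + h) - X t) h h'

theorem HasBackwardDeriv.unique {X : ℝ → Ω → E} {t : ℝ} {V W : Ω → E}
    (h : HasBackwardDeriv P fut X t V) (h' : HasBackwardDeriv P fut X t W) : V =ᵐ[P] W :=
  HasCondDeriv.unique (Δ := fun h => X t - X (t - h)) h h'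

variable [SecondCountableTopology E]

namespace HasC1Derivs

variable {X V U : ℝ → Ω → E}

theorem stronglyMeasurable_fwd (h : HasC1Derivs P past fut a b X V U) :
    StronglyMeasurable (Function.uncurry (fwd P past a b X)) :=
  (fwd_spec_of_exists h.forward h.cont_forward).1

theorem stronglyMeasurable_bwd (h : HasC1Derivs P past fut a b X V U) :
    StronglyMeasurable (Function.uncurry (bwd P fut a b X)) :=
  (bwd_spec_of_exists h.backward h.cont_backward).1

theorem fwd_ae_eq (h : HasC1Derivs P past fut a b X V U) :
    ∀ t ∈ Ioo a b, V t =ᵐ[P] fwd P past a b X t := fun t ht =>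
  (h.forward t ht).unique ((fwd_spec_of_exists h.forward h.cont_forward).2 t ht)

theorem bwd_ae_eq (h : HasC1Derivs P past fut a b X V U) :
    ∀ t ∈ Ioo a b, U t =ᵐ[P] bwd P fut a b X t := fun t ht =>
  (h.backward t ht).unique ((bwd_spec_of_exists h.backward h.cont_backward).2 t ht)

theorem canonical (h : HasC1Derivs P past fut a b X V U) :
    HasC1Derivs P past fut a b X (fwd P past a b X) (bwd P fut a b X) :=
  h.congr h.fwd_ae_eq h.bwd_ae_eq

theorem mem_C1 (h : HasC1Derivs P past fut a b X V U) : X ∈ C1 P past fut a b := by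
  refine ⟨⟨h.isS0, ⟨V, h.forward, h.cont_forward⟩, ⟨U, h.backward, h.cont_backward⟩⟩, ?_⟩
  obtain ⟨M, hM, hb⟩ := h.canonical.bounded
  refine lt_of_le_of_lt (iSup₂_le fun t ht => ?_)
    (ENNReal.add_lt_top.2 ⟨ENNReal.add_lt_top.2 ⟨hM, hM⟩, hM⟩)
  obtain ⟨h1, h2, h3⟩ := hb t ht
  exact add_le_add (add_le_add h1 h2) h3

end HasC1Derivs

theorem eLpNorm_le_c1Norm (X : ℝ → Ω → E) {t : ℝ} (ht : t ∈ Ioo a b) :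
    eLpNorm (X t) 2 P ≤ c1Norm P past fut a b X ∧
    eLpNorm (fwd P past a b X t) 2 P ≤ c1Norm P past fut a b X ∧
    eLpNorm (bwd P fut a b X t) 2 P ≤ c1Norm P past fut a b X := by
  have h : eLpNorm (X t) 2 P + eLpNorm (fwd P past a b X t) 2 P
      + eLpNorm (bwd P fut a b X t) 2 P ≤ c1Norm P past fut a b X :=
    le_iSup₂ (f := fun t (_ : t ∈ Ioo a b) => eLpNorm (X t) 2 P
      + eLpNorm (fwd P past a b X t) 2 P + eLpNorm (bwd P fut a b X t) 2 P) t ht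
  exact ⟨(le_self_add.trans le_self_add).trans h, (le_add_self.trans le_self_add).trans h,
    le_add_self.trans h⟩

/-- With `HasC1Derivs.mem_C1` this translates between membership in `C1` and explicit derivatives,
for which the calculus above is stated. -/
theorem hasC1Derivs_of_mem_C1 {X : ℝ → Ω → E} (h : X ∈ C1 P past fut a b) :
    HasC1Derivs P past fut a b X (fwd P past a b X) (bwd P fut a b X) := by
  obtain ⟨⟨h0, ⟨V, hV, hVc⟩, ⟨U, hU, hUc⟩⟩, hb⟩ := h
  have hF := fwd_spec_of_exists hV hVc
  have hB := bwd_spec_of_exists hU hUc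
  exact
    { isS0 := h0
      forward := hF.2
      backward := hB.2
      cont_forward := hVc.congr fun t ht => (hV t ht).unique (hF.2 t ht)
      cont_backward := hUc.congr fun t ht => (hU t ht).unique (hB.2 t ht)
      bounded := ⟨_, hb, fun t ht => eLpNorm_le_c1Norm X ht⟩ }

/-- A process with continuous paths that is measurable at each time is jointly measurable. To have
all paths continuous on the whole line, the process is set to zero on a null set and frozen outside
[a, b]. -/
theorem IsS0.exists_stronglyMeasurable {X : ℝ → Ω → E} (hab : a ≤ b)
    (hX : IsS0 P past fut a b X) :
    ∃ Y : ℝ → Ω → E, StronglyMeasurable (Function.uncurry Y) ∧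
      ∀ᵐ ω ∂P, ∀ t ∈ Icc a b, X t ω = Y t ω := by
  classical
  -- The set of discontinuous paths need not be measurable, so a measurable null set containing it
  -- is removed.
  set N := toMeasurable P {ω | ContinuousOn (fun t => X t ω) (Icc a b)}ᶜ with hN
  have hN0 : P N = 0 := by
    rw [hN, measure_toMeasurable]
    exact hX.continuous_paths
  have hNm : MeasurableSet N := measurableSet_toMeasurable _ _
  let Y : ℝ → Ω → E := fun t => Nᶜ.indicator (X (projIcc a b hab t))
  refine ⟨Y, stronglyMeasurable_uncurry_of_continuous_of_stronglyMeasurable (fun ω => ?_)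
    fun t => ?_, ?_⟩
  · by_cases hω : ω ∈ N
    · have : (fun t => Y t ω) = fun _ => 0 := by
        ext t
        simp [Y, hω]
      rw [this]
      exact continuous_const
    · have : (fun t => Y t ω) = fun t => X (projIcc a b hab t) ω := by
        ext t
        simp [Y, hω]
      rw [this]
      have hc : ContinuousOn (fun t => X t ω) (Icc a b) := by
        by_contra hcon
        exact hω (subset_toMeasurable _ _ hcon)
      exact hc.comp_continuous (continuous_subtype_val.comp continuous_projIcc)
        fun t => (projIcc a b hab t).2
  · exact ((hX.adapted_past _ (projIcc a b hab t).2).mono (past.le _)).indicator hNm.compl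
  · filter_upwards [measure_eq_zero_iff_ae_notMem.1 hN0] with ω hω t ht
    simp [Y, hω, projIcc_of_mem hab ht]

end Processes

/-! ### Integration over time and chance. -/

section TimeChance

variable {Ω : Type*} {m0 : MeasurableSpace Ω} {P : Measure Ω} [IsFiniteMeasure P]
  {past : Filtration ℝ m0} {fut : Filtration ℝᵒᵈ m0} {a b : ℝ}
  {E : Type*} [NormedAddCommGroup E]

/-- The product of Lebesgue measure on `I = (a, b)` with `P`. -/
def timeChance (P : Measure Ω) (a b : ℝ) : Measure (ℝ × Ω) :=
  (volume.restrict (Ioo a b)).prod P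

instance : IsFiniteMeasure (timeChance P a b) := by
  unfold timeChance
  infer_instance

/-- Fubini for the set where `V` and `W` agree. Strongly measurable modifications come first, to
make that set measurable. -/
theorem ae_timeChance_of_forall {V W : ℝ → Ω → E}
    (hV : AEStronglyMeasurable (Function.uncurry V) (timeChance P a b))
    (hW : AEStronglyMeasurable (Function.uncurry W) (timeChance P a b))
    (h : ∀ t ∈ Ioo a b, V t =ᵐ[P] W t) :
    Function.uncurry V =ᵐ[timeChance P a b] Function.uncurry W := by
  refine hV.ae_eq_mk.trans (EventuallyEq.trans ?_ hW.ae_eq_mk.symm)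
  have hm : MeasurableSet {p | hV.mk _ p = hW.mk _ p} :=
    hV.stronglyMeasurable_mk.measurableSet_eq_fun hW.stronglyMeasurable_mk
  refine (Measure.ae_prod_iff_ae_ae hm).2 ?_
  filter_upwards [Measure.ae_ae_of_ae_prod hV.ae_eq_mk, Measure.ae_ae_of_ae_prod hW.ae_eq_mk,
    ae_restrict_mem measurableSet_Ioo] with t h1 h2 ht
  filter_upwards [h1, h2, h t ht] with ω h1 h2 h3
  rw [← h1, ← h2]
  exact h3

theorem IsS0.aestronglyMeasurable_uncurry [NormedSpace ℝ E] {X : ℝ → Ω → E} (hab : a ≤ b)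
    [CompleteSpace E] [SecondCountableTopology E] (hX : IsS0 P past fut a b X) :
    AEStronglyMeasurable (Function.uncurry X) (timeChance P a b) := by
  obtain ⟨Y, hY, hXY⟩ := hX.exists_stronglyMeasurable hab
  refine ⟨Function.uncurry Y, hY, ?_⟩
  filter_upwards [Measure.quasiMeasurePreserving_snd.ae hXY,
    Measure.quasiMeasurePreserving_fst.ae (ae_restrict_mem measurableSet_Ioo)] with p h1 h2
  exact h1 p.1 (Ioo_subset_Icc_self h2)

theorem lintegral_timeChance_sq_le {V : ℝ → Ω → E}
    (hV : AEStronglyMeasurable (Function.uncurry V) (timeChance P a b)) {M : ℝ≥0∞}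
    (hb : ∀ t ∈ Ioo a b, eLpNorm (V t) 2 P ≤ M) :
    ∫⁻ p, ‖Function.uncurry V p‖ₑ ^ 2 ∂(timeChance P a b) ≤ M ^ 2 * ENNReal.ofReal (b - a) := by
  have hV' : AEMeasurable (fun p => ‖Function.uncurry V p‖ₑ ^ 2) (timeChance P a b) :=
    hV.enorm.pow_const 2
  rw [timeChance, lintegral_prod _ hV']
  calc ∫⁻ t in Ioo a b, ∫⁻ ω, ‖V t ω‖ₑ ^ 2 ∂P ≤ ∫⁻ _ in Ioo a b, M ^ 2 := by
        refine setLIntegral_mono measurable_const fun t ht => ?_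
        have := eLpNorm_nnreal_pow_eq_lintegral (f := V t) (μ := P) (p := 2) (by norm_num)
        simp only [NNReal.coe_ofNat, ENNReal.rpow_ofNat, ENNReal.coe_ofNat] at this
        rw [← this]
        exact pow_le_pow_left₀ zero_le (hb t ht) 2
    _ = M ^ 2 * ENNReal.ofReal (b - a) := by simp

theorem memLp_timeChance {V : ℝ → Ω → E}
    (hV : AEStronglyMeasurable (Function.uncurry V) (timeChance P a b)) {M : ℝ≥0∞} (hM : M < ⊤)
    (hb : ∀ t ∈ Ioo a b, eLpNorm (V t) 2 P ≤ M) :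
    MemLp (Function.uncurry V) 2 (timeChance P a b) := by
  refine ⟨hV, ?_⟩
  have h1 := lintegral_timeChance_sq_le hV hb
  have h2 := eLpNorm_nnreal_pow_eq_lintegral (f := Function.uncurry V) (μ := timeChance P a b)
    (p := 2) (by norm_num)
  simp only [NNReal.coe_ofNat, ENNReal.rpow_ofNat, ENNReal.coe_ofNat] at h2
  rw [← h2] at h1
  have h3 := h1.trans_lt (ENNReal.mul_lt_top (ENNReal.pow_lt_top hM) ENNReal.ofReal_lt_top)
  by_contra hcon
  rw [not_lt, top_le_iff] at hcon
  rw [hcon] at h3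
  simp at h3

end TimeChance

/-! ### Bilinear pairings E[B(f, g)] and conditional expectations. -/

section Pairing

variable {Ω ι : Type*} {m m0 : MeasurableSpace Ω} {P : Measure Ω} {l : Filter ι}
  {E F G : Type*} [NormedAddCommGroup E] [NormedSpace ℝ E]
  [NormedAddCommGroup F] [NormedSpace ℝ F]
  [NormedAddCommGroup G] [NormedSpace ℝ G] [CompleteSpace G]
  (B : E →L[ℝ] F →L[ℝ] G)

/-- The pairing `E[B(f, g)]` of two square integrable random variables. -/
def pairing (P : Measure Ω) (B : E →L[ℝ] F →L[ℝ] G) (f : Ω → E) (g : Ω → F) : G :=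
  ∫ ω, B (f ω) (g ω) ∂P

theorem integrable_bilin {f : Ω → E} {g : Ω → F} (hf : MemLp f 2 P) (hg : MemLp g 2 P) :
    Integrable (fun ω => B (f ω) (g ω)) P :=
  memLp_one_iff_integrable.1 (B.memLp_of_bilin 1 hf hg)

theorem pairing_congr {f f' : Ω → E} {g g' : Ω → F} (hf : f =ᵐ[P] f') (hg : g =ᵐ[P] g') :
    pairing P B f g = pairing P B f' g' := by
  refine integral_congr_ae ?_
  filter_upwards [hf, hg] with ω h1 h2
  rw [h1, h2]

theorem pairing_eq_lpPairing {f : Ω → E} {g : Ω → F} (hf : MemLp f 2 P) (hg : MemLp g 2 P) :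
    pairing P B f g = B.lpPairing P 2 2 (hf.toLp f) (hg.toLp g) := by
  rw [ContinuousLinearMap.lpPairing_eq_integral]
  exact pairing_congr B hf.coeFn_toLp.symm hg.coeFn_toLp.symm

theorem pairing_add_left {f f' : Ω → E} {g : Ω → F} (hf : MemLp f 2 P) (hf' : MemLp f' 2 P)
    (hg : MemLp g 2 P) : pairing P B (f + f') g = pairing P B f g + pairing P B f' g := by
  simp only [pairing, Pi.add_apply, map_add, _root_.add_apply]
  exact integral_add (integrable_bilin B hf hg) (integrable_bilin B hf' hg)

theorem pairing_smul_left (c : ℝ) (f : Ω → E) (g : Ω → F) :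
    pairing P B (c • f) g = c • pairing P B f g := by
  simp only [pairing, Pi.smul_apply, map_smul, _root_.smul_apply]
  exact integral_smul _ _

theorem pairing_smul_right (c : ℝ) (f : Ω → E) (g : Ω → F) :
    pairing P B f (c • g) = c • pairing P B f g := by
  simp only [pairing, Pi.smul_apply, map_smul]
  exact integral_smul _ _

theorem pairing_sub_left {f f' : Ω → E} {g : Ω → F} (hf : MemLp f 2 P) (hf' : MemLp f' 2 P)
    (hg : MemLp g 2 P) : pairing P B (f - f') g = pairing P B f g - pairing P B f' g := by
  simp only [pairing, Pi.sub_apply, map_sub, _root_.sub_apply]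
  exact integral_sub (integrable_bilin B hf hg) (integrable_bilin B hf' hg)

theorem pairing_flip (f : Ω → E) (g : Ω → F) : pairing P B.flip g f = pairing P B f g := rfl

theorem norm_pairing_le {f : Ω → E} {g : Ω → F} (hf : MemLp f 2 P) (hg : MemLp g 2 P)
    {M N : ℝ≥0∞} (hM : M < ⊤) (hN : N < ⊤) (hfM : eLpNorm f 2 P ≤ M) (hgN : eLpNorm g 2 P ≤ N) :
    ‖pairing P B f g‖ ≤ ‖B.lpPairing P 2 2‖ * M.toReal * N.toReal := by
  rw [pairing_eq_lpPairing B hf hg]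
  refine (ContinuousLinearMap.le_opNorm₂ _ _ _).trans ?_
  rw [Lp.norm_toLp, Lp.norm_toLp]
  have h1 := ENNReal.toReal_mono hM.ne hfM
  have h2 := ENNReal.toReal_mono hN.ne hgN
  gcongr

theorem TendstoL2.pairing {f : ι → Ω → E} {f0 : Ω → E} {g : ι → Ω → F} {g0 : Ω → F}
    (hf : TendstoL2 P l f f0) (hg : TendstoL2 P l g g0) (hfm : ∀ᶠ i in l, MemLp (f i) 2 P)
    (hgm : ∀ᶠ i in l, MemLp (g i) 2 P) (hf0 : MemLp f0 2 P) (hg0 : MemLp g0 2 P) :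
    Tendsto (fun i => pairing P B (f i) (g i)) l (𝓝 (pairing P B f0 g0)) := by
  classical
  -- The value 0 is taken only at indices which the filter eventually excludes.
  let u : ι → Lp E 2 P := fun i => if h : MemLp (f i) 2 P then h.toLp else 0
  let v : ι → Lp F 2 P := fun i => if h : MemLp (g i) 2 P then h.toLp else 0
  have hu : Tendsto u l (𝓝 (hf0.toLp f0)) := by
    refine hf.tendsto_toLp ?_ hf0.coeFn_toLp
    filter_upwards [hfm] with i hi
    simp only [u, dif_pos hi]
    exact hi.coeFn_toLp
  have hv : Tendsto v l (𝓝 (hg0.toLp g0)) := by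
    refine hg.tendsto_toLp ?_ hg0.coeFn_toLp
    filter_upwards [hgm] with i hi
    simp only [v, dif_pos hi]
    exact hi.coeFn_toLp
  rw [pairing_eq_lpPairing B hf0 hg0]
  have hc : Continuous fun p : Lp E 2 P × Lp F 2 P => B.lpPairing P 2 2 p.1 p.2 :=
    (B.lpPairing P 2 2).continuous₂
  refine ((hc.tendsto (hf0.toLp f0, hg0.toLp g0)).comp (hu.prodMk_nhds hv)).congr' ?_
  filter_upwards [hfm, hgm] with i hi hi'
  simp only [Function.comp_apply, u, v, dif_pos hi, dif_pos hi']
  exact (pairing_eq_lpPairing B hi hi').symm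

theorem tendstoL2_const (f : Ω → E) : TendstoL2 P l (fun _ => f) f := by
  simp only [TendstoL2, sub_self, eLpNorm_zero]
  exact tendsto_const_nhds

theorem pairing_condExp [IsFiniteMeasure P] [CompleteSpace E] [CompleteSpace F] (hm : m ≤ m0)
    {f : Ω → E} {g : Ω → F}
    (hf : MemLp f 2 P) (hg : MemLp g 2 P) (hgm : StronglyMeasurable[m] g) :
    pairing P B (condExp m P f) g = pairing P B f g := by
  have h := condExp_bilin_of_stronglyMeasurable_right B hgm (integrable_bilin B hf hg)
    (hf.integrable (by norm_num))
  rw [pairing, ← integral_congr_ae h, integral_condExp hm]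
  rfl

/-- Against an `m`-measurable `g` the conditional expectation drops out, so a conditional derivative
becomes an ordinary one-sided derivative of a deterministic function. -/
theorem HasCondDeriv.tendsto_pairing [IsFiniteMeasure P] [CompleteSpace E] [CompleteSpace F]
    (hm : m ≤ m0) {Δ : ℝ → Ω → E} {V : Ω → E} {g : Ω → F} (h : HasCondDeriv P m Δ V)
    (hΔ : ∀ᶠ s in 𝓝[>] 0, MemLp (Δ s) 2 P) (hg : MemLp g 2 P) (hgm : StronglyMeasurable[m] g) :
    Tendsto (fun s : ℝ => s⁻¹ • pairing P B (Δ s) g) (𝓝[>] 0) (𝓝 (pairing P B V g)) := by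
  have h1 := TendstoL2.pairing B h.2 (tendstoL2_const g)
    (h.2.eventually_memLp (Eventually.of_forall fun _ => aestronglyMeasurable_quotient _ _) h.1)
    (Eventually.of_forall fun _ => hg) h.1 hg
  refine h1.congr' ?_
  filter_upwards [hΔ] with s hs
  rw [pairing_smul_left, pairing_condExp B hm hs hg hgm]

end Pairing

/-! ### Nelson's product rule and integration by parts. -/

theorem hasDerivWithinAt_Ioi_of_tendsto {G : Type*} [NormedAddCommGroup G] [NormedSpace ℝ G]
    {f : ℝ → G} {f' : G} {x : ℝ}
    (h : Tendsto (fun s : ℝ => s⁻¹ • (f (x + s) - f x)) (𝓝[>] 0) (𝓝 f')) :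
    HasDerivWithinAt f f' (Ioi x) x := by
  rw [hasDerivWithinAt_iff_tendsto_slope' (by simp)]
  have h1 : Tendsto (fun y : ℝ => y - x) (𝓝[>] x) (𝓝[>] 0) := by
    refine tendsto_nhdsWithin_iff.2 ⟨?_, ?_⟩
    · exact Tendsto.mono_left (Continuous.tendsto' (by fun_prop) x 0 (by simp)) nhdsWithin_le_nhds
    · filter_upwards [self_mem_nhdsWithin] with y hy
      simpa using hy
  refine (h.comp h1).congr fun y => ?_
  simp [slope, vsub_eq_sub]

section PartialIntegration

variable {Ω : Type*} {m0 : MeasurableSpace Ω} {P : Measure Ω} [IsFiniteMeasure P]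
  {past : Filtration ℝ m0} {fut : Filtration ℝᵒᵈ m0} {a b : ℝ}
  {E F G : Type*} [NormedAddCommGroup E] [NormedSpace ℝ E] [CompleteSpace E]
  [NormedAddCommGroup F] [NormedSpace ℝ F] [CompleteSpace F]
  [NormedAddCommGroup G] [NormedSpace ℝ G] [CompleteSpace G]
  (B : E →L[ℝ] F →L[ℝ] G)

theorem L2ContinuousOn.tendsto {V : ℝ → Ω → E} (hV : L2ContinuousOn P a b V) {t : ℝ}
    (ht : t ∈ Ioo a b) : TendstoL2 P (𝓝 t) V (V t) := by
  have := hV t ht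
  rwa [isOpen_Ioo.nhdsWithin_eq ht] at this

theorem eventually_memLp_of_mem_Ioo {V : ℝ → Ω → E} (hV : ∀ t ∈ Ioo a b, MemLp (V t) 2 P) {t : ℝ}
    (ht : t ∈ Ioo a b) : ∀ᶠ s in 𝓝 t, MemLp (V s) 2 P := by
  filter_upwards [isOpen_Ioo.mem_nhds ht] with s hs using hV s hs

theorem continuousOn_pairing {V : ℝ → Ω → E} {U : ℝ → Ω → F} (hV : L2ContinuousOn P a b V)
    (hU : L2ContinuousOn P a b U) (hVm : ∀ t ∈ Ioo a b, MemLp (V t) 2 P)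
    (hUm : ∀ t ∈ Ioo a b, MemLp (U t) 2 P) :
    ContinuousOn (fun t => pairing P B (V t) (U t)) (Ioo a b) := fun t ht =>
  ((hV.tendsto ht).pairing B (hU.tendsto ht) (eventually_memLp_of_mem_Ioo hVm ht)
    (eventually_memLp_of_mem_Ioo hUm ht) (hVm t ht) (hUm t ht)).mono_left nhdsWithin_le_nhds

theorem L2ContinuousOn.const (g : Ω → F) : L2ContinuousOn P a b fun _ => g := fun _ _ =>
  tendstoL2_const g

/-- Nelson's formula `E[X_t - X_s | past_s] = E[∫_s^t DX_u du | past_s]`, in weak form. -/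
theorem integral_pairing_forward {X V : ℝ → Ω → E} (hX : IsS0 P past fut a b X)
    (hV : ∀ t ∈ Ioo a b, HasForwardDeriv P past X t (V t)) (hVc : L2ContinuousOn P a b V)
    {s t : ℝ} (hs : s ∈ Ioo a b) (ht : t ∈ Ioo a b) (hst : s ≤ t) {g : Ω → F}
    (hg : MemLp g 2 P) (hgm : StronglyMeasurable[past s] g) :
    ∫ u in s..t, pairing P B (V u) g = pairing P B (X t) g - pairing P B (X s) g := by
  have hsub : Icc s t ⊆ Ioo a b := fun u hu => ⟨hs.1.trans_le hu.1, hu.2.trans_lt ht.2⟩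
  have hXm : ∀ t ∈ Ioo a b, MemLp (X t) 2 P := fun t ht => hX.memLp_Ioo ht
  -- A continuous function with an integrable right derivative obeys the fundamental theorem of
  -- calculus. At each `u` after `s` the variable `g` is still measurable for the past, since that
  -- filtration increases.
  refine intervalIntegral.integral_eq_sub_of_hasDeriv_right_of_le
    (f := fun u => pairing P B (X u) g) hst ?_ (fun u hu => ?_) ?_
  · exact (continuousOn_pairing B hX.l2ContinuousOn (.const g) hXm fun _ _ => hg).mono hsub
  · have hu' := hsub (Ioo_subset_Icc_self hu)
    refine hasDerivWithinAt_Ioi_of_tendsto ?_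
    have hev := eventually_add_mem_Ioo hu'
    refine (HasCondDeriv.tendsto_pairing B (past.le u) (hV u hu') ?_ hg
      (hgm.mono (past.mono hu.1.le))).congr' ?_
    · filter_upwards [hev] with h hh using (hXm _ hh).sub (hXm _ hu')
    · filter_upwards [hev] with h hh
      rw [pairing_sub_left B (hXm _ hh) (hXm _ hu') hg]
  · refine ContinuousOn.intervalIntegrable ?_
    rw [uIcc_of_le hst]
    exact (continuousOn_pairing B hVc (.const g) (fun t ht => (hV t ht).1)
      fun _ _ => hg).mono hsub

/-- Nelson's formula `E[X_t - X_s | fut_t] = E[∫_s^t D_*X_u du | fut_t]`, in weak form. -/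
theorem integral_pairing_backward {X V : ℝ → Ω → E} (hX : IsS0 P past fut a b X)
    (hV : ∀ t ∈ Ioo a b, HasBackwardDeriv P fut X t (V t)) (hVc : L2ContinuousOn P a b V)
    {s t : ℝ} (hs : s ∈ Ioo a b) (ht : t ∈ Ioo a b) (hst : s ≤ t) {g : Ω → F}
    (hg : MemLp g 2 P) (hgm : StronglyMeasurable[fut (OrderDual.toDual t)] g) :
    ∫ u in s..t, pairing P B (V u) g = pairing P B (X t) g - pairing P B (X s) g := by
  have hsub : Icc s t ⊆ Ioo a b := fun u hu => ⟨hs.1.trans_le hu.1, hu.2.trans_lt ht.2⟩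
  have hneg : MapsTo (fun u : ℝ => -u) (Icc (-t) (-s)) (Icc s t) := fun u hu =>
    ⟨by linarith [hu.2], by linarith [hu.1]⟩
  have hXm : ∀ t ∈ Ioo a b, MemLp (X t) 2 P := fun t ht => hX.memLp_Ioo ht
  -- Time is reversed, since D_* yields left derivatives while the fundamental theorem is applied to
  -- right ones. The future filtration decreases, so `g` stays measurable at all earlier times.
  have key : ∫ u in (-t)..(-s), -pairing P B (V (-u)) g
      = pairing P B (X (- -s)) g - pairing P B (X (- -t)) g := by
    refine intervalIntegral.integral_eq_sub_of_hasDeriv_right_of_le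
      (f := fun u => pairing P B (X (-u)) g) (neg_le_neg hst) ?_ (fun u hu => ?_) ?_
    · exact ((continuousOn_pairing B hX.l2ContinuousOn (.const g) hXm fun _ _ => hg).mono
        hsub).comp continuous_neg.continuousOn hneg
    · have hu' := hsub (hneg (Ioo_subset_Icc_self hu))
      refine hasDerivWithinAt_Ioi_of_tendsto ?_
      have hev := eventually_sub_mem_Ioo hu'
      have hle : -u ≤ t := by linarith [hu.1]
      refine ((HasCondDeriv.tendsto_pairing B (fut.le (OrderDual.toDual (-u))) (hV (-u) hu') ?_ hg
        (hgm.mono (fut.mono (OrderDual.toDual_le_toDual.2 hle)))).neg).congr' ?_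
      · filter_upwards [hev] with h hh using (hXm _ hu').sub (hXm _ hh)
      · filter_upwards [hev] with h hh
        rw [pairing_sub_left B (hXm _ hu') (hXm _ hh) hg, neg_add', ← smul_neg, neg_sub]
    · refine ContinuousOn.intervalIntegrable ?_
      rw [uIcc_of_le (neg_le_neg hst)]
      exact (((continuousOn_pairing B hVc (.const g) (fun t ht => (hV t ht).1)
        fun _ _ => hg).mono hsub).comp continuous_neg.continuousOn hneg).neg
  rw [intervalIntegral.integral_neg, intervalIntegral.integral_comp_neg
    (fun u => pairing P B (V u) g)] at key
  simp only [neg_neg] at key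
  rw [← neg_sub, ← key, neg_neg]

/-- `d/dt E[B(X_t, Y_t)] = E[B(DX_t, Y_t)] + E[B(X_t, D_*Y_t)]`. -/
theorem hasDerivWithinAt_pairing {X V : ℝ → Ω → E} {Y U : ℝ → Ω → F}
    (hX : IsS0 P past fut a b X)
    (hV : ∀ t ∈ Ioo a b, HasForwardDeriv P past X t (V t)) (hVc : L2ContinuousOn P a b V)
    (hY : IsS0 P past fut a b Y)
    (hU : ∀ t ∈ Ioo a b, HasBackwardDeriv P fut Y t (U t)) (hUc : L2ContinuousOn P a b U)
    {t : ℝ} (ht : t ∈ Ioo a b) :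
    HasDerivWithinAt (fun t => pairing P B (X t) (Y t))
      (pairing P B (V t) (Y t) + pairing P B (X t) (U t)) (Ioi t) t := by
  have hXm : ∀ t ∈ Ioo a b, MemLp (X t) 2 P := fun t ht => hX.memLp_Ioo ht
  have hYm : ∀ t ∈ Ioo a b, MemLp (Y t) 2 P := fun t ht => hY.memLp_Ioo ht
  have hVm : ∀ t ∈ Ioo a b, MemLp (V t) 2 P := fun t ht => (hV t ht).1
  have hUm : ∀ t ∈ Ioo a b, MemLp (U t) 2 P := fun t ht => (hU t ht).1
  -- Two time variables are needed: in the increment over [t, t+h] the factor X is evaluated at t +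
  -- h, the derivatives at the integration variable.
  have h1 : Tendsto (fun p : ℝ × ℝ => pairing P B (V p.2) (Y t) + pairing P B (X p.1) (U p.2))
      (𝓝 (t, t)) (𝓝 (pairing P B (V t) (Y t) + pairing P B (X t) (U t))) := by
    have c1 : Tendsto Prod.fst (𝓝 (t, t)) (𝓝 t) := continuous_fst.tendsto (t, t)
    have c2 : Tendsto Prod.snd (𝓝 (t, t)) (𝓝 t) := continuous_snd.tendsto (t, t)
    refine Tendsto.add ?_ ?_
    · exact ((hVc.tendsto ht).comp c2).pairing B (tendstoL2_const _)
        (c2.eventually (eventually_memLp_of_mem_Ioo hVm ht))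
        (Eventually.of_forall fun _ => hYm t ht) (hVm t ht) (hYm t ht)
    · exact ((hX.l2ContinuousOn.tendsto ht).comp c1).pairing B ((hUc.tendsto ht).comp c2)
        (c1.eventually (eventually_memLp_of_mem_Ioo hXm ht))
        (c2.eventually (eventually_memLp_of_mem_Ioo hUm ht)) (hXm t ht) (hUm t ht)
  refine hasDerivWithinAt_Ioi_of_tendsto ?_
  rw [Metric.tendsto_nhds]
  intro ε hε
  obtain ⟨δ, hδ, hb⟩ := Metric.tendsto_nhds_nhds.1 h1 (ε / 2) (half_pos hε)
  filter_upwards [eventually_add_mem_Ioo ht, Ioo_mem_nhdsGT hδ] with h hh hhδ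
  have hle : t ≤ t + h := by linarith [hhδ.1]
  have hsub : Icc t (t + h) ⊆ Ioo a b := fun u hu => ⟨ht.1.trans_le hu.1, hu.2.trans_lt hh.2⟩
  -- The increment is (X_{t+h} - X_t) Y_t + X_{t+h} (Y_{t+h} - Y_t). The weak formulas apply because
  -- Y_t is measurable for the past at t and X_{t+h} for the future at t + h.
  have e1 := integral_pairing_forward B hX hV hVc ht hh hle (hYm t ht)
    (hY.adapted_past t (Ioo_subset_Icc_self ht))
  have e2 := integral_pairing_backward B.flip hY hU hUc ht hh hle (hXm _ hh)
    (hX.adapted_fut _ (Ioo_subset_Icc_self hh))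
  simp only [pairing_flip] at e2
  have i1 : IntervalIntegrable (fun u => pairing P B (V u) (Y t)) volume t (t + h) := by
    refine ContinuousOn.intervalIntegrable ?_
    rw [uIcc_of_le hle]
    exact (continuousOn_pairing B hVc (.const _) hVm fun _ _ => hYm t ht).mono hsub
  have i2 : IntervalIntegrable (fun u => pairing P B (X (t + h)) (U u)) volume t (t + h) := by
    refine ContinuousOn.intervalIntegrable ?_
    rw [uIcc_of_le hle]
    exact (continuousOn_pairing B (.const _) hUc (fun _ _ => hXm _ hh) hUm).mono hsub
  have e3 : pairing P B (X (t + h)) (Y (t + h)) - pairing P B (X t) (Y t)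
      = ∫ u in t..(t + h), (pairing P B (V u) (Y t) + pairing P B (X (t + h)) (U u)) := by
    rw [intervalIntegral.integral_add i1 i2, e1, e2]
    abel
  set φ := pairing P B (V t) (Y t) + pairing P B (X t) (U t) with hφ
  have e4 : h⁻¹ • (pairing P B (X (t + h)) (Y (t + h)) - pairing P B (X t) (Y t)) - φ
      = h⁻¹ • ∫ u in t..(t + h),
        (pairing P B (V u) (Y t) + pairing P B (X (t + h)) (U u) - φ) := by
    rw [intervalIntegral.integral_sub (i1.add i2) (by simp), ← e3,
      intervalIntegral.integral_const, add_sub_cancel_left, smul_sub h⁻¹ _ (h • φ), smul_smul,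
      inv_mul_cancel₀ hhδ.1.ne', one_smul]
  have e5 : ‖∫ u in t..(t + h),
        (pairing P B (V u) (Y t) + pairing P B (X (t + h)) (U u) - φ)‖ ≤ ε / 2 * |t + h - t| := by
    refine intervalIntegral.norm_integral_le_of_norm_le_const fun u hu => ?_
    rw [uIoc_of_le hle] at hu
    rw [← dist_eq_norm]
    refine (hb (x := (t + h, u)) ?_).le
    rw [Prod.dist_eq, max_lt_iff, Real.dist_eq, Real.dist_eq]
    constructor
    · simpa [abs_of_pos hhδ.1] using hhδ.2
    · rw [abs_of_pos (by linarith [hu.1])]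
      linarith [hu.2, hhδ.2]
  rw [dist_eq_norm, e4, norm_smul, norm_inv, Real.norm_of_nonneg hhδ.1.le]
  rw [add_sub_cancel_left, abs_of_pos hhδ.1] at e5
  have hpos := hhδ.1
  calc h⁻¹ * _ ≤ h⁻¹ * (ε / 2 * h) := by gcongr
    _ = ε / 2 := by field_simp
    _ < ε := half_lt_self hε

theorem integrableOn_pairing {V : ℝ → Ω → E} {U : ℝ → Ω → F} (hV : L2ContinuousOn P a b V)
    (hU : L2ContinuousOn P a b U) (hVm : ∀ t ∈ Ioo a b, MemLp (V t) 2 P)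
    (hUm : ∀ t ∈ Ioo a b, MemLp (U t) 2 P) {M N : ℝ≥0∞} (hM : M < ⊤) (hN : N < ⊤)
    (hVM : ∀ t ∈ Ioo a b, eLpNorm (V t) 2 P ≤ M) (hUN : ∀ t ∈ Ioo a b, eLpNorm (U t) 2 P ≤ N) :
    IntegrableOn (fun t => pairing P B (V t) (U t)) (Ioo a b) := by
  refine Integrable.of_bound ?_ (‖B.lpPairing P 2 2‖ * M.toReal * N.toReal) ?_
  · exact (continuousOn_pairing B hV hU hVm hUm).aestronglyMeasurable measurableSet_Ioo
  · filter_upwards [ae_restrict_mem measurableSet_Ioo] with t ht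
    exact norm_pairing_le B (hVm t ht) (hUm t ht) hM hN (hVM t ht) (hUN t ht)

/-- Nelson's formula of integration by parts. -/
theorem integral_pairing_by_parts (hab : a < b) {X V V' : ℝ → Ω → E} {Y U U' : ℝ → Ω → F}
    (hX : HasC1Derivs P past fut a b X V V') (hY : HasC1Derivs P past fut a b Y U U') :
    IntegrableOn (fun t => pairing P B (V t) (Y t)) (Ioo a b) ∧
    IntegrableOn (fun t => pairing P B (X t) (U' t)) (Ioo a b) ∧
    (∫ t in Ioo a b, pairing P B (V t) (Y t)) + ∫ t in Ioo a b, pairing P B (X t) (U' t)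
      = pairing P B (X b) (Y b) - pairing P B (X a) (Y a) := by
  obtain ⟨M, hM, hMb⟩ := hX.bounded
  obtain ⟨N, hN, hNb⟩ := hY.bounded
  have hXm : ∀ t ∈ Ioo a b, MemLp (X t) 2 P := fun t ht => hX.isS0.memLp_Ioo ht
  have hYm : ∀ t ∈ Ioo a b, MemLp (Y t) 2 P := fun t ht => hY.isS0.memLp_Ioo ht
  have i1 := integrableOn_pairing B hX.cont_forward hY.isS0.l2ContinuousOn hX.memLp_forward hYm
    hM hN (fun t ht => (hMb t ht).2.1) fun t ht => (hNb t ht).1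
  have i2 := integrableOn_pairing B hX.isS0.l2ContinuousOn hY.cont_backward hXm hY.memLp_backward
    hM hN (fun t ht => (hMb t ht).1) fun t ht => (hNb t ht).2.2
  refine ⟨i1, i2, ?_⟩
  rw [← integral_add i1 i2, ← integral_Ioc_eq_integral_Ioo,
    ← intervalIntegral.integral_of_le hab.le]
  refine intervalIntegral.integral_eq_sub_of_hasDeriv_right_of_le
    (f := fun t => pairing P B (X t) (Y t)) hab.le (fun t ht => ?_) (fun t ht => ?_) ?_
  · exact TendstoL2.pairing B (hX.isS0.continuous_L2 t ht) (hY.isS0.continuous_L2 t ht)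
      (eventually_nhdsWithin_of_forall hX.isS0.memLp)
      (eventually_nhdsWithin_of_forall hY.isS0.memLp) (hX.isS0.memLp t ht) (hY.isS0.memLp t ht)
  · exact hasDerivWithinAt_pairing B hX.isS0 hX.forward hX.cont_forward hY.isS0 hY.backward
      hY.cont_backward ht
  · rw [intervalIntegrable_iff_integrableOn_Ioo_of_le hab.le]
    exact i1.add i2

end PartialIntegration

/-! ### The Lagrangian: growth, Taylor's formula, and affinity of ∂_v L. -/

section Lagrangian

variable {d : ℕ} {L : RVec d → CVec d → ℂ}

/-- The total (real) derivative of the Lagrangian. -/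
def totalDeriv (L : RVec d → CVec d → ℂ) (p : RVec d × CVec d) : RVec d × CVec d →L[ℝ] ℂ :=
  fderiv ℝ (Function.uncurry L) p

theorem totalDeriv_fst (hL : BoundedSecondDerivs L) (x : RVec d) (v : CVec d) (z : RVec d) :
    fderiv ℝ (fun y => L y v) x z = totalDeriv L (x, v) (z, 0) := by
  have h : HasFDerivAt (fun y => L y v)
      ((totalDeriv L (x, v)).comp (ContinuousLinearMap.inl ℝ (RVec d) (CVec d))) x :=
    HasFDerivAt.comp (f := fun y => (y, v)) x (hL.1 (x, v)).hasFDerivAt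
      (hasFDerivAt_prodMk_left x v)
  rw [h.fderiv]
  simp

theorem hasFDerivAt_snd (hL : BoundedSecondDerivs L) (x : RVec d) (v : CVec d) :
    HasFDerivAt (L x) ((totalDeriv L (x, v)).comp (ContinuousLinearMap.inr ℝ (RVec d) (CVec d)))
      v :=
  HasFDerivAt.comp (f := fun w => (x, w)) v (hL.1 (x, v)).hasFDerivAt
    (hasFDerivAt_prodMk_right x v)

/-- Both are real derivatives of `L x`, which are unique. Thus the total derivative is complex
linear in the v-directions. -/
theorem totalDeriv_snd (hA : Admissible L) (hL : BoundedSecondDerivs L) (x : RVec d) (v w : CVec d) :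
    fderiv ℂ (L x) v w = totalDeriv L (x, v) (0, w) := by
  have h1 := ((hA x v).hasFDerivAt.restrictScalars ℝ).unique (hasFDerivAt_snd hL x v)
  simpa using DFunLike.congr_fun h1 w

theorem totalDeriv_I_smul (hA : Admissible L) (hL : BoundedSecondDerivs L) (p : RVec d × CVec d)
    (w : CVec d) :
    totalDeriv L p (0, Complex.I • w) = Complex.I * totalDeriv L p (0, w) := by
  obtain ⟨x, v⟩ := p
  rw [← totalDeriv_snd hA hL, ← totalDeriv_snd hA hL, map_smul, smul_eq_mul]

/-- The second derivative of the Lagrangian. -/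
def secondDeriv (L : RVec d → CVec d → ℂ) (p : RVec d × CVec d) :
    RVec d × CVec d →L[ℝ] RVec d × CVec d →L[ℝ] ℂ :=
  fderiv ℝ (fderiv ℝ (Function.uncurry L)) p

theorem hasFDerivAt_totalDeriv_apply (hL : BoundedSecondDerivs L) (p h : RVec d × CVec d) :
    HasFDerivAt (fun q => totalDeriv L q h) ((secondDeriv L p).flip h) p := by
  have h1 : HasFDerivAt (totalDeriv L) (secondDeriv L p) p := (hL.2.1 p).hasFDerivAt
  have h2 := (ContinuousLinearMap.apply ℝ ℂ h).hasFDerivAt.comp p h1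
  exact h2

/-- Symmetry holds at any point where the first derivative is differentiable; continuity of the
second derivative is not required. -/
theorem secondDeriv_comm (hL : BoundedSecondDerivs L) (p h k : RVec d × CVec d) :
    secondDeriv L p h k = secondDeriv L p k h :=
  second_derivative_symmetric (f := Function.uncurry L)
    (fun q => (hL.1 q).hasFDerivAt) (hL.2.1 p).hasFDerivAt h k

/-- Differentiate the identity `totalDeriv_I_smul` in the base point. -/
theorem secondDeriv_I_smul_right (hA : Admissible L) (hL : BoundedSecondDerivs L)
    (p h : RVec d × CVec d) (w : CVec d) :
    secondDeriv L p h (0, Complex.I • w) = Complex.I * secondDeriv L p h (0, w) := by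
  have h1 := hasFDerivAt_totalDeriv_apply hL p (0, Complex.I • w)
  have h2 := (hasFDerivAt_totalDeriv_apply hL p (0, w)).const_mul Complex.I
  have h3 := h1.unique (h2.congr_of_eventuallyEq
    (Eventually.of_forall fun q => totalDeriv_I_smul hA hL q w))
  exact DFunLike.congr_fun h3 h

theorem secondDeriv_I_smul_left (hA : Admissible L) (hL : BoundedSecondDerivs L)
    (p h : RVec d × CVec d) (w : CVec d) :
    secondDeriv L p (0, Complex.I • w) h = Complex.I * secondDeriv L p (0, w) h := by
  rw [secondDeriv_comm hL, secondDeriv_I_smul_right hA hL, secondDeriv_comm hL]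

/-- All first derivatives of the Lagrangian are holomorphic in the second variable. -/
theorem differentiable_totalDeriv_apply (hA : Admissible L) (hL : BoundedSecondDerivs L)
    (x : RVec d) (h : RVec d × CVec d) :
    Differentiable ℂ (fun v => totalDeriv L (x, v) h) := by
  intro v
  have h1 : HasFDerivAt (fun v => totalDeriv L (x, v) h)
      (((secondDeriv L (x, v)).flip h).comp (ContinuousLinearMap.inr ℝ (RVec d) (CVec d))) v :=
    HasFDerivAt.comp (f := fun w => (x, w)) v (hasFDerivAt_totalDeriv_apply hL (x, v) h)
      (hasFDerivAt_prodMk_right x v)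
  -- A real differentiable map is complex differentiable as soon as its real derivative is complex
  -- linear; here that derivative is the second derivative with first slot (0, w), which commutes
  -- with multiplication by i.
  rw [differentiableAt_iff_restrictScalars ℝ h1.differentiableAt, h1.fderiv]
  refine ⟨⟨⟨⟨fun w => secondDeriv L (x, v) (0, w) h, fun w w' => ?_⟩, fun c w => ?_⟩, ?_⟩, ?_⟩
  · have : ((0 : RVec d), w + w') = (0, w) + (0, w') := by simp
    rw [this, map_add]
    rfl
  · have : ((0 : RVec d), c • w) = c.re • ((0 : RVec d), w) + c.im • (0, Complex.I • w) := by
      have e : c • w = c.re • w + c.im • Complex.I • w := by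
        conv_lhs => rw [← Complex.re_add_im c, add_smul, mul_smul]
        rfl
      rw [e]
      simp
    simp only [this, map_add, map_smul, _root_.add_apply,
      _root_.smul_apply, secondDeriv_I_smul_left hA hL, RingHom.id_apply,
      Complex.real_smul, smul_eq_mul]
    conv_rhs => rw [← Complex.re_add_im c]
    ring
  · exact (((secondDeriv L (x, v)).flip h).comp
      (ContinuousLinearMap.inr ℝ (RVec d) (CVec d))).continuous
  · ext w
    rfl

theorem exists_lipschitz_totalDeriv (hL : BoundedSecondDerivs L) :
    ∃ K : ℝ, 0 ≤ K ∧ ∀ p q, ‖totalDeriv L q - totalDeriv L p‖ ≤ K * ‖q - p‖ := by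
  obtain ⟨_, h2, K, hK⟩ := hL
  refine ⟨K, le_trans (norm_nonneg (fderiv ℝ (fderiv ℝ (Function.uncurry L)) 0)) (hK 0), fun p q => ?_⟩
  exact convex_univ.norm_image_sub_le_of_norm_fderiv_le (fun p _ => h2 p) (fun p _ => hK p)
    (mem_univ p) (mem_univ q)

/-- By Liouville's theorem, the increments of the first derivatives of the Lagrangian do not depend
on the second variable. -/
theorem totalDeriv_increment (hA : Admissible L) (hL : BoundedSecondDerivs L) (x : RVec d)
    (q h : RVec d × CVec d) (v w : CVec d) :
    totalDeriv L ((x, v) + q) h - totalDeriv L (x, v) h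
      = totalDeriv L ((x, w) + q) h - totalDeriv L (x, w) h := by
  have hd : Differentiable ℂ
      (fun v => totalDeriv L ((x, v) + q) h - totalDeriv L (x, v) h) := by
    refine Differentiable.sub ?_ (differentiable_totalDeriv_apply hA hL x h)
    exact (differentiable_totalDeriv_apply hA hL (x + q.1) h).comp
      (differentiable_id.add_const q.2)
  obtain ⟨K, _, hK⟩ := exists_lipschitz_totalDeriv hL
  -- The Lipschitz bound K‖q‖‖h‖ does not involve `v`, so the entire function is bounded.
  refine hd.apply_eq_apply_of_bounded ?_ v w
  rw [isBounded_iff_forall_norm_le]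
  refine ⟨K * ‖q‖ * ‖h‖, ?_⟩
  rintro _ ⟨v, rfl⟩
  have h1 := hK (x, v) ((x, v) + q)
  rw [add_sub_cancel_left] at h1
  simp only [← _root_.sub_apply]
  exact ((totalDeriv L ((x, v) + q) - totalDeriv L (x, v)).le_opNorm h).trans (by gcongr)

/-- The increment by `q` of a first derivative is constant in v, so its derivative in the direction
(0, w) vanishes. -/
theorem secondDeriv_snd_const (hA : Admissible L) (hL : BoundedSecondDerivs L)
    (p q h : RVec d × CVec d) (w : CVec d) :
    secondDeriv L (p + q) (0, w) h = secondDeriv L p (0, w) h := by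
  obtain ⟨x, v⟩ := p
  have h1 : HasFDerivAt (fun p => totalDeriv L (p + q) h - totalDeriv L p h)
      ((secondDeriv L ((x, v) + q)).flip h - (secondDeriv L (x, v)).flip h) (x, v) := by
    refine HasFDerivAt.sub ?_ (hasFDerivAt_totalDeriv_apply hL (x, v) h)
    exact HasFDerivAt.comp (f := fun p => p + q) (x, v)
      (hasFDerivAt_totalDeriv_apply hL ((x, v) + q) h) ((hasFDerivAt_id (x, v)).add_const q)
  have h2 := HasFDerivAt.comp (f := fun w => (x, w)) v h1 (hasFDerivAt_prodMk_right x v)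
  have h3 := h2.unique ((hasFDerivAt_const (totalDeriv L ((x, v) + q) h - totalDeriv L (x, v) h)
    v).congr_of_eventuallyEq (Eventually.of_forall fun w =>
      totalDeriv_increment hA hL x q h w v))
  have h4 := DFunLike.congr_fun h3 w
  simp only [ContinuousLinearMap.comp_apply, _root_.sub_apply,
    ContinuousLinearMap.flip_apply, ContinuousLinearMap.inr_apply,
    _root_.zero_apply] at h4
  exact sub_eq_zero.1 h4

/-- The derivatives of the Lagrangian in the second variable are affine functions. -/
theorem totalDeriv_snd_affine (hA : Admissible L) (hL : BoundedSecondDerivs L)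
    (p : RVec d × CVec d) (w : CVec d) :
    totalDeriv L p (0, w) = totalDeriv L 0 (0, w) + secondDeriv L 0 p (0, w) := by
  -- By symmetry the derivative of the v-component in any direction is a second derivative with a
  -- slot in v, hence the same at `p` as at the origin. Subtracting this linear map leaves a
  -- constant.
  have h1 : ∀ p, HasFDerivAt (fun q => totalDeriv L q (0, w) - (secondDeriv L 0).flip (0, w) q)
      (0 : RVec d × CVec d →L[ℝ] ℂ) p := by
    intro p
    have h := (hasFDerivAt_totalDeriv_apply hL p (0, w)).sub
      ((secondDeriv L 0).flip (0, w)).hasFDerivAt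
    have e : (secondDeriv L p).flip (0, w) = (secondDeriv L 0).flip (0, w) := by
      refine ContinuousLinearMap.ext fun h => ?_
      have := secondDeriv_snd_const hA hL 0 p h w
      rw [zero_add] at this
      rw [ContinuousLinearMap.flip_apply, ContinuousLinearMap.flip_apply,
        secondDeriv_comm hL p, secondDeriv_comm hL 0, this]
    rw [e, sub_self] at h
    exact h
  have h2 := is_const_of_fderiv_eq_zero (𝕜 := ℝ) (fun p => (h1 p).differentiableAt)
    (fun p => (h1 p).fderiv) p 0
  simp only [map_zero, sub_zero] at h2
  rw [← h2]
  simp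

theorem dv_apply (hA : Admissible L) (hL : BoundedSecondDerivs L) (x : RVec d) (v : CVec d)
    (k : Fin d) : dv L x v k = totalDeriv L (x, v) (0, EuclideanSpace.single k 1) := by
  rw [← totalDeriv_snd hA hL]
  rfl

theorem dx_apply (hL : BoundedSecondDerivs L) (x : RVec d) (v : CVec d) (k : Fin d) :
    dx L x v k = totalDeriv L (x, v) (EuclideanSpace.single k 1, 0) := by
  rw [← totalDeriv_fst hL]
  rfl

/-- The derivative `∂_v L` is an affine function. -/
theorem exists_dv_eq (hA : Admissible L) (hL : BoundedSecondDerivs L) :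
    ∃ (c : CVec d) (T : RVec d × CVec d →L[ℝ] CVec d), ∀ x v, dv L x v = c + T (x, v) := by
  let T0 : RVec d × CVec d →L[ℝ] (Fin d → ℂ) := ContinuousLinearMap.pi fun k =>
    (secondDeriv L 0).flip (0, EuclideanSpace.single k 1)
  let T : RVec d × CVec d →L[ℝ] CVec d :=
    ((PiLp.continuousLinearEquiv 2 ℝ fun _ : Fin d => ℂ).symm : (Fin d → ℂ) →L[ℝ] CVec d).comp T0
  refine ⟨dv L 0 0, T, fun x v => ?_⟩
  ext k
  rw [dv_apply hA hL, totalDeriv_snd_affine hA hL, PiLp.add_apply, dv_apply hA hL]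
  rfl

/-- The bilinear pairing `∑ u_k z_k` of `ℂ^d` and `ℝ^d`. -/
def dotR (d : ℕ) : CVec d →L[ℝ] RVec d →L[ℝ] ℂ :=
  ∑ k : Fin d, (((ContinuousLinearMap.lsmul ℝ ℝ (E := ℂ)).flip.comp
    ((EuclideanSpace.proj k : CVec d →L[ℂ] ℂ).restrictScalars ℝ)).flip.comp
      (EuclideanSpace.proj k : RVec d →L[ℝ] ℝ)).flip

theorem dotR_apply (u : CVec d) (z : RVec d) : dotR d u z = ∑ k, u k * (z k : ℂ) := by
  simp [dotR, mul_comm]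

/-- The v-part is a sum without conjugation because the derivative is complex linear there; this
lets the complex coefficients of 𝒟_μ be moved across the pairing. -/
theorem totalDeriv_eq_dot (hA : Admissible L) (hL : BoundedSecondDerivs L) (x z : RVec d)
    (v w : CVec d) :
    totalDeriv L (x, v) (z, w) = dotR d (dx L x v) z + ∑ k, dv L x v k * w k := by
  have h1 : (z, w) = (z, 0) + ((0 : RVec d), w) := by simp
  rw [h1, map_add]
  congr 1
  · have hz : z = ∑ k, z k • EuclideanSpace.single k (1 : ℝ) := by
      ext j
      simp [Pi.single_apply]
    conv_lhs => rw [← totalDeriv_fst hL, hz, map_sum]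
    rw [dotR_apply]
    refine Finset.sum_congr rfl fun k _ => ?_
    rw [map_smul, Complex.real_smul, mul_comm, dx_apply hL, totalDeriv_fst hL]
  · have hw : w = ∑ k, w k • EuclideanSpace.single k (1 : ℂ) := by
      ext j
      simp [Pi.single_apply]
    conv_lhs => rw [← totalDeriv_snd hA hL, hw, map_sum]
    refine Finset.sum_congr rfl fun k _ => ?_
    rw [map_smul, smul_eq_mul, mul_comm, dv_apply hA hL, totalDeriv_snd hA hL]

theorem norm_totalDeriv_le (hL : BoundedSecondDerivs L) :
    ∃ K : ℝ, 0 ≤ K ∧ ∀ p, ‖totalDeriv L p‖ ≤ K * (1 + ‖p‖) := by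
  obtain ⟨K, hK0, hK⟩ := exists_lipschitz_totalDeriv hL
  refine ⟨K + ‖totalDeriv L 0‖, by positivity, fun p => ?_⟩
  have h1 := hK 0 p
  rw [sub_zero] at h1
  have h2 : ‖totalDeriv L p‖ ≤ ‖totalDeriv L p - totalDeriv L 0‖ + ‖totalDeriv L 0‖ := by
    simpa using norm_add_le (totalDeriv L p - totalDeriv L 0) (totalDeriv L 0)
  nlinarith [norm_nonneg p, norm_nonneg (totalDeriv L 0)]

/-- Taylor's formula of first order. -/
theorem exists_taylor (hL : BoundedSecondDerivs L) :
    ∃ K : ℝ, 0 ≤ K ∧ ∀ p h, ‖Function.uncurry L (p + h) - Function.uncurry L p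
      - totalDeriv L p h‖ ≤ K * ‖h‖ ^ 2 := by
  obtain ⟨K, hK0, hK⟩ := exists_lipschitz_totalDeriv hL
  refine ⟨K, hK0, fun p h => ?_⟩
  -- On the ball of radius ‖h‖ around `p` the derivative differs from that at `p` by at most K‖h‖.
  have h1 := (convex_closedBall p ‖h‖).norm_image_sub_le_of_norm_fderiv_le'
    (𝕜 := ℝ) (f := Function.uncurry L) (φ := totalDeriv L p) (C := K * ‖h‖) (x := p) (y := p + h)
    (fun q _ => hL.1 q) (fun q hq => ?_) (by simp) (by simp)
  · rw [add_sub_cancel_left] at h1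
    rwa [sq, ← mul_assoc]
  · refine (hK p q).trans ?_
    rw [mem_closedBall_iff_norm] at hq
    gcongr

theorem exists_quadratic_growth (hL : BoundedSecondDerivs L) :
    ∃ K : ℝ, 0 ≤ K ∧ ∀ p, ‖Function.uncurry L p‖ ≤ K * (1 + ‖p‖ ^ 2) := by
  obtain ⟨K, hK0, hK⟩ := exists_taylor hL
  refine ⟨K + ‖Function.uncurry L 0‖ + ‖totalDeriv L 0‖, by positivity, fun p => ?_⟩
  have h1 := hK 0 p
  rw [zero_add] at h1
  have h2 := (totalDeriv L 0).le_opNorm p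
  have h3 : ‖Function.uncurry L p‖ ≤ ‖Function.uncurry L p - Function.uncurry L 0
      - totalDeriv L 0 p‖ + ‖totalDeriv L 0 p‖ + ‖Function.uncurry L 0‖ := by
    have e : Function.uncurry L p = (Function.uncurry L p - Function.uncurry L 0
      - totalDeriv L 0 p) + totalDeriv L 0 p + Function.uncurry L 0 := by ring
    calc _ = _ := congrArg norm e
      _ ≤ _ := norm_add₃_le
  have h4 : ‖p‖ ≤ 1 + ‖p‖ ^ 2 := by nlinarith [sq_nonneg (‖p‖ - 1 / 2)]
  have h5 : ‖totalDeriv L 0‖ * ‖p‖ ≤ ‖totalDeriv L 0‖ * (1 + ‖p‖ ^ 2) := by gcongr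
  nlinarith [norm_nonneg (Function.uncurry L 0), sq_nonneg ‖p‖]

end Lagrangian

/-! ### The operator 𝒟_μ in terms of its coefficients. -/

section NelsonMap

variable {d : ℕ}

/-- The coefficient `(1 + i μ) / 2` of `D` in `𝒟_μ`. -/
def coef (μ : ℝ) : ℂ := 1 / 2 + Complex.I * (μ : ℂ) / 2

/-- In this form, interchanging D and D_* visibly amounts to replacing μ by -μ. -/
theorem combine_eq (μ : ℝ) (u w : CVec d) : combine μ u w = coef μ • u + coef (-μ) • w := by
  ext k
  simp only [combine, coef, PiLp.add_apply, PiLp.smul_apply, PiLp.sub_apply, smul_eq_mul,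
    Complex.ofReal_neg]
  ring

/-- The inclusion `ℝ^d ⊆ ℂ^d` as a continuous linear map. -/
def toCL (d : ℕ) : RVec d →L[ℝ] CVec d :=
  LinearMap.toContinuousLinearMap
    { toFun := toC
      map_add' := fun x y => by ext k; simp [toC]
      map_smul' := fun r x => by ext k; simp [toC] }

/-- The contribution of `DX` to `𝒟_μ X`, as a real linear map. -/
def nelsonL (d : ℕ) (μ : ℝ) : RVec d →L[ℝ] CVec d := coef μ • toCL d

theorem combine_toC (μ : ℝ) (x y : RVec d) :
    combine μ (toC x) (toC y) = nelsonL d μ x + nelsonL d (-μ) y := by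
  rw [combine_eq]
  rfl

theorem sum_mul_nelsonL (μ : ℝ) (u : CVec d) (x : RVec d) :
    ∑ k, u k * nelsonL d μ x k = coef μ * dotR d u x := by
  rw [dotR_apply, Finset.mul_sum]
  refine Finset.sum_congr rfl fun k _ => ?_
  have : nelsonL d μ x k = coef μ * (x k : ℂ) := rfl
  rw [this]
  ring

/-- As a map `dotR` is declared real bilinear only; complex homogeneity in the first slot is
recorded separately. -/
theorem dotR_smul (c : ℂ) (u : CVec d) (z : RVec d) : dotR d (c • u) z = c * dotR d u z := by
  simp only [dotR_apply, PiLp.smul_apply, smul_eq_mul, Finset.mul_sum, mul_assoc]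

end NelsonMap

/-! ### Differentiability of the functional and uniqueness of the differential. -/

section Jet

variable {Ω : Type*} {m0 : MeasurableSpace Ω} {P : Measure Ω} [IsFiniteMeasure P]
  {past : Filtration ℝ m0} {fut : Filtration ℝᵒᵈ m0} {a b : ℝ} {d : ℕ} {μ : ℝ}
  {L : RVec d → CVec d → ℂ}

/-- The process `(X, 𝒟_μ X)`. -/
def jet (P : Measure Ω) (past : Filtration ℝ m0) (fut : Filtration ℝᵒᵈ m0) (a b μ : ℝ)
    (X : ℝ → Ω → RVec d) : ℝ → Ω → RVec d × CVec d := fun t ω =>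
  (X t ω, nelson P past fut a b μ X t ω)

theorem jet_eq (X : ℝ → Ω → RVec d) (t : ℝ) (ω : Ω) : jet P past fut a b μ X t ω =
    ContinuousLinearMap.inl ℝ (RVec d) (CVec d) (X t ω)
    + (ContinuousLinearMap.inr ℝ (RVec d) (CVec d)).comp (nelsonL d μ) (fwd P past a b X t ω)
    + (ContinuousLinearMap.inr ℝ (RVec d) (CVec d)).comp (nelsonL d (-μ)) (bwd P fut a b X t ω) := by
  simp [jet, nelson, combine_toC]

theorem aestronglyMeasurable_jet (hab : a ≤ b) {X : ℝ → Ω → RVec d} (hX : X ∈ C1 P past fut a b) :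
    AEStronglyMeasurable (Function.uncurry (jet P past fut a b μ X)) (timeChance P a b) := by
  have h := hasC1Derivs_of_mem_C1 hX
  have e : Function.uncurry (jet P past fut a b μ X) = fun p =>
      ContinuousLinearMap.inl ℝ (RVec d) (CVec d) (Function.uncurry X p)
      + (ContinuousLinearMap.inr ℝ (RVec d) (CVec d)).comp (nelsonL d μ)
        (Function.uncurry (fwd P past a b X) p)
      + (ContinuousLinearMap.inr ℝ (RVec d) (CVec d)).comp (nelsonL d (-μ))
        (Function.uncurry (bwd P fut a b X) p) := by
    ext1 p
    exact jet_eq X p.1 p.2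
  rw [e]
  exact ((ContinuousLinearMap.continuous _).comp_aestronglyMeasurable
    (h.isS0.aestronglyMeasurable_uncurry hab)).add
    ((ContinuousLinearMap.continuous _).comp_aestronglyMeasurable
      h.stronglyMeasurable_fwd.aestronglyMeasurable) |>.add
    ((ContinuousLinearMap.continuous _).comp_aestronglyMeasurable
      h.stronglyMeasurable_bwd.aestronglyMeasurable)

/-- The constant in the bound of the `L²`-norms of `(X, 𝒟_μ X)` by the norm of `X`. -/
def jetBound (d : ℕ) (μ : ℝ) : ℝ :=
  ‖ContinuousLinearMap.inl ℝ (RVec d) (CVec d)‖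
    + ‖(ContinuousLinearMap.inr ℝ (RVec d) (CVec d)).comp (nelsonL d μ)‖
    + ‖(ContinuousLinearMap.inr ℝ (RVec d) (CVec d)).comp (nelsonL d (-μ))‖

theorem jetBound_nonneg (d : ℕ) (μ : ℝ) : 0 ≤ jetBound d μ := by
  unfold jetBound
  positivity

theorem eLpNorm_jet_le {X : ℝ → Ω → RVec d} (hX : X ∈ C1 P past fut a b) {t : ℝ}
    (ht : t ∈ Ioo a b) : eLpNorm (jet P past fut a b μ X t) 2 P
      ≤ ENNReal.ofReal (jetBound d μ) * c1Norm P past fut a b X := by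
  have h := hasC1Derivs_of_mem_C1 hX
  obtain ⟨h1, h2, h3⟩ := eLpNorm_le_c1Norm (P := P) (past := past) (fut := fut) X ht
  have e : jet P past fut a b μ X t =
      ((fun ω => ContinuousLinearMap.inl ℝ (RVec d) (CVec d) (X t ω))
      + fun ω => (ContinuousLinearMap.inr ℝ (RVec d) (CVec d)).comp (nelsonL d μ)
        (fwd P past a b X t ω))
      + fun ω => (ContinuousLinearMap.inr ℝ (RVec d) (CVec d)).comp (nelsonL d (-μ))
        (bwd P fut a b X t ω) := by
    ext1 ω
    exact jet_eq X t ω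
  have m1 := (ContinuousLinearMap.inl ℝ (RVec d) (CVec d)).comp_memLp' (h.isS0.memLp_Ioo ht)
  have m2 := ((ContinuousLinearMap.inr ℝ (RVec d) (CVec d)).comp (nelsonL d μ)).comp_memLp'
    (h.memLp_forward t ht)
  have m3 := ((ContinuousLinearMap.inr ℝ (RVec d) (CVec d)).comp (nelsonL d (-μ))).comp_memLp'
    (h.memLp_backward t ht)
  rw [e, jetBound, ENNReal.ofReal_add (by positivity) (by positivity),
    ENNReal.ofReal_add (by positivity) (by positivity), add_mul, add_mul]
  refine (eLpNorm_add_le (m1.1.add m2.1) m3.1 (by norm_num)).trans (add_le_add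
    ((eLpNorm_add_le m1.1 m2.1 (by norm_num)).trans (add_le_add ?_ ?_)) ?_)
  · exact (eLpNorm_clm_comp_le _ _).trans (by gcongr)
  · exact (eLpNorm_clm_comp_le _ _).trans (by gcongr)
  · exact (eLpNorm_clm_comp_le _ _).trans (by gcongr)

theorem memLp_jet (hab : a ≤ b) {X : ℝ → Ω → RVec d} (hX : X ∈ C1 P past fut a b) :
    MemLp (Function.uncurry (jet P past fut a b μ X)) 2 (timeChance P a b) :=
  memLp_timeChance (aestronglyMeasurable_jet hab hX)
    (ENNReal.mul_lt_top ENNReal.ofReal_lt_top hX.2) fun _ ht => eLpNorm_jet_le hX ht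

theorem integral_jet_sq_le (hab : a ≤ b) {X : ℝ → Ω → RVec d} (hX : X ∈ C1 P past fut a b) :
    ∫ p, ‖Function.uncurry (jet P past fut a b μ X) p‖ ^ 2 ∂(timeChance P a b)
      ≤ (jetBound d μ * (c1Norm P past fut a b X).toReal) ^ 2 * (b - a) := by
  have hm := aestronglyMeasurable_jet (μ := μ) hab hX
  have h := lintegral_timeChance_sq_le hm fun t ht => eLpNorm_jet_le hX ht
  have hm2 : AEStronglyMeasurable
      (fun p => ‖Function.uncurry (jet P past fut a b μ X) p‖ ^ 2) (timeChance P a b) :=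
    hm.norm.pow 2
  rw [integral_eq_lintegral_of_nonneg_ae (ae_of_all _ fun _ => by positivity) hm2]
  have e : ∀ p, ENNReal.ofReal (‖Function.uncurry (jet P past fut a b μ X) p‖ ^ 2)
      = ‖Function.uncurry (jet P past fut a b μ X) p‖ₑ ^ 2 := fun p => by
    rw [ENNReal.ofReal_pow (norm_nonneg _), ofReal_norm]
  simp only [e]
  refine (ENNReal.toReal_mono ?_ h).trans (le_of_eq ?_)
  · exact (ENNReal.mul_lt_top (ENNReal.pow_lt_top (ENNReal.mul_lt_top ENNReal.ofReal_lt_top hX.2))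
      ENNReal.ofReal_lt_top).ne
  · rw [ENNReal.toReal_mul, ENNReal.toReal_pow, ENNReal.toReal_mul,
      ENNReal.toReal_ofReal (jetBound_nonneg d μ), ENNReal.toReal_ofReal (sub_nonneg.2 hab)]

theorem smul_add_smul_mem_C1 {X Z : ℝ → Ω → RVec d} (hX : X ∈ C1 P past fut a b)
    (hZ : Z ∈ C1 P past fut a b) (r s : ℝ) : r • X + s • Z ∈ C1 P past fut a b :=
  (((hasC1Derivs_of_mem_C1 hX).const_smul r).add ((hasC1Derivs_of_mem_C1 hZ).const_smul s)).mem_C1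

/-- The versions `fwd` and `bwd` are chosen separately for each process, so linearity can be
expected only almost everywhere. -/
theorem jet_smul_add_smul (hab : a ≤ b) {X Z : ℝ → Ω → RVec d} (hX : X ∈ C1 P past fut a b)
    (hZ : Z ∈ C1 P past fut a b) (r s : ℝ) :
    Function.uncurry (jet P past fut a b μ (r • X + s • Z)) =ᵐ[timeChance P a b]
      fun p => r • Function.uncurry (jet P past fut a b μ X) p
        + s • Function.uncurry (jet P past fut a b μ Z) p := by
  have h := ((hasC1Derivs_of_mem_C1 hX).const_smul r).add ((hasC1Derivs_of_mem_C1 hZ).const_smul s)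
  refine ae_timeChance_of_forall
    (W := fun t ω => r • jet P past fut a b μ X t ω + s • jet P past fut a b μ Z t ω)
    (aestronglyMeasurable_jet hab h.mem_C1)
    (((aestronglyMeasurable_jet hab hX).const_smul r).add
      ((aestronglyMeasurable_jet hab hZ).const_smul s)) fun t ht => ?_
  filter_upwards [h.fwd_ae_eq t ht, h.bwd_ae_eq t ht] with ω h1 h2
  simp only [jet_eq, ← h1, ← h2, Pi.add_apply, Pi.smul_apply, map_add, map_smul, smul_add]
  abel

theorem jet_add (hab : a ≤ b) {X Z : ℝ → Ω → RVec d} (hX : X ∈ C1 P past fut a b)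
    (hZ : Z ∈ C1 P past fut a b) :
    Function.uncurry (jet P past fut a b μ (X + Z)) =ᵐ[timeChance P a b]
      fun p => Function.uncurry (jet P past fut a b μ X) p
        + Function.uncurry (jet P past fut a b μ Z) p := by
  simpa using jet_smul_add_smul (μ := μ) hab hX hZ 1 1

theorem add_mem_C1 {X Z : ℝ → Ω → RVec d} (hX : X ∈ C1 P past fut a b)
    (hZ : Z ∈ C1 P past fut a b) : X + Z ∈ C1 P past fut a b := by
  simpa using smul_add_smul_mem_C1 hX hZ 1 1

theorem integrable_lagrangian (hab : a ≤ b) (hL : BoundedSecondDerivs L) {X : ℝ → Ω → RVec d}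
    (hX : X ∈ C1 P past fut a b) :
    Integrable (fun p => Function.uncurry L (Function.uncurry (jet P past fut a b μ X) p))
      (timeChance P a b) := by
  obtain ⟨K, hK0, hK⟩ := exists_quadratic_growth hL
  have hm := memLp_jet (μ := μ) hab hX
  have hi : Integrable (fun p => K * (1 + ‖Function.uncurry (jet P past fut a b μ X) p‖ ^ 2))
      (timeChance P a b) :=
    ((integrable_const 1).add (hm.integrable_norm_pow (by norm_num))).const_mul K
  exact hi.mono' (hL.1.continuous.comp_aestronglyMeasurable hm.1) (ae_of_all _ fun p => hK _)

/-- Quadratic growth of `L` against the square integrable process (X, 𝒟_μ X) on a bounded time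
interval. -/
theorem mem_Xi_of_mem_C1 (hab : a ≤ b) (hL : BoundedSecondDerivs L) {X : ℝ → Ω → RVec d}
    (hX : X ∈ C1 P past fut a b) : X ∈ Xi P past fut a b μ L := by
  refine ⟨hX, ?_⟩
  have h := integrable_lagrangian (μ := μ) hab hL hX
  have h2 := h.2
  rw [hasFiniteIntegral_iff_enorm, timeChance, lintegral_prod_symm _ h.1.enorm] at h2
  exact h2

theorem functional_eq (hab : a ≤ b) (hL : BoundedSecondDerivs L) {X : ℝ → Ω → RVec d}
    (hX : X ∈ C1 P past fut a b) : functional P past fut a b μ L X =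
      ∫ p, Function.uncurry L (Function.uncurry (jet P past fut a b μ X) p) ∂(timeChance P a b) := by
  rw [timeChance, integral_prod_symm _ (integrable_lagrangian hab hL hX)]
  rfl

theorem admissibleVariations_eq (hab : a ≤ b) (hL : BoundedSecondDerivs L) :
    admissibleVariations P past fut a b μ L (C1 P past fut a b) = C1 P past fut a b := by
  ext Z
  exact ⟨fun h => h.1, fun h => ⟨h, fun X hX => mem_Xi_of_mem_C1 hab hL (add_mem_C1 h hX.1)⟩⟩

theorem memLp_totalDeriv_jet (hab : a ≤ b) (hL : BoundedSecondDerivs L) {X : ℝ → Ω → RVec d}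
    (hX : X ∈ C1 P past fut a b) :
    MemLp (fun p => totalDeriv L (Function.uncurry (jet P past fut a b μ X) p)) 2
      (timeChance P a b) := by
  obtain ⟨K, hK0, hK⟩ := norm_totalDeriv_le hL
  have hm := memLp_jet (μ := μ) hab hX
  have hc : Continuous (totalDeriv L) := hL.2.1.continuous
  have h1 : MemLp (fun _ : ℝ × Ω => (1 : ℝ)) 2 (timeChance P a b) := memLp_const 1
  have h2 : MemLp (fun p => ‖Function.uncurry (jet P past fut a b μ X) p‖) 2 (timeChance P a b) :=
    hm.norm
  have h3 : MemLp (fun p => K * (1 + ‖Function.uncurry (jet P past fut a b μ X) p‖)) 2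
      (timeChance P a b) := (h1.add h2).const_mul K
  exact h3.mono' (hc.comp_aestronglyMeasurable hm.1) (ae_of_all _ fun p => hK _)

/-- The first variation of the functional. -/
def firstVariation (P : Measure Ω) (past : Filtration ℝ m0) (fut : Filtration ℝᵒᵈ m0) (a b μ : ℝ)
    (L : RVec d → CVec d → ℂ) (X Z : ℝ → Ω → RVec d) : ℂ :=
  ∫ p, totalDeriv L (Function.uncurry (jet P past fut a b μ X) p)
    (Function.uncurry (jet P past fut a b μ Z) p) ∂(timeChance P a b)

theorem integrable_firstVariation (hab : a ≤ b) (hL : BoundedSecondDerivs L)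
    {X Z : ℝ → Ω → RVec d} (hX : X ∈ C1 P past fut a b) (hZ : Z ∈ C1 P past fut a b) :
    Integrable (fun p => totalDeriv L (Function.uncurry (jet P past fut a b μ X) p)
      (Function.uncurry (jet P past fut a b μ Z) p)) (timeChance P a b) :=
  integrable_bilin (ContinuousLinearMap.id ℝ (RVec d × CVec d →L[ℝ] ℂ))
    (memLp_totalDeriv_jet hab hL hX) (memLp_jet hab hZ)

theorem firstVariation_smul_add_smul (hab : a ≤ b) (hL : BoundedSecondDerivs L)
    {X Z W : ℝ → Ω → RVec d} (hX : X ∈ C1 P past fut a b) (hZ : Z ∈ C1 P past fut a b)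
    (hW : W ∈ C1 P past fut a b) (r s : ℝ) :
    firstVariation P past fut a b μ L X (r • Z + s • W)
      = r * firstVariation P past fut a b μ L X Z + s * firstVariation P past fut a b μ L X W := by
  have h1 := integrable_firstVariation (μ := μ) hab hL hX hZ
  have h2 := integrable_firstVariation (μ := μ) hab hL hX hW
  rw [firstVariation, firstVariation, firstVariation, ← integral_const_mul, ← integral_const_mul,
    ← integral_add (h1.const_mul _) (h2.const_mul _)]
  refine integral_congr_ae ?_
  filter_upwards [jet_smul_add_smul (μ := μ) hab hZ hW r s] with p hp
  rw [hp, map_add, map_smul, map_smul, Complex.real_smul, Complex.real_smul]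

/-- Taylor's remainder is at most K times the squared jet of `Z`, and the integral of that square is
controlled by the squared norm of `Z`. -/
theorem exists_firstVariation_bound (hab : a ≤ b) (hL : BoundedSecondDerivs L)
    {X : ℝ → Ω → RVec d} (hX : X ∈ C1 P past fut a b) :
    ∃ K : ℝ, 0 ≤ K ∧ ∀ Z ∈ C1 P past fut a b,
      ‖functional P past fut a b μ L (X + Z) - functional P past fut a b μ L X
        - firstVariation P past fut a b μ L X Z‖ ≤ K * (c1Norm P past fut a b Z).toReal ^ 2 := by
  obtain ⟨K, hK0, hK⟩ := exists_taylor hL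
  refine ⟨K * (jetBound d μ ^ 2 * (b - a)),
    mul_nonneg hK0 (mul_nonneg (sq_nonneg _) (sub_nonneg.2 hab)), fun Z hZ => ?_⟩
  have i1 := integrable_lagrangian (μ := μ) hab hL (add_mem_C1 hX hZ)
  have i2 := integrable_lagrangian (μ := μ) hab hL hX
  have i3 := integrable_firstVariation (μ := μ) hab hL hX hZ
  have i12 : Integrable (fun p => Function.uncurry L
      (Function.uncurry (jet P past fut a b μ (X + Z)) p)
      - Function.uncurry L (Function.uncurry (jet P past fut a b μ X) p)) (timeChance P a b) :=
    i1.sub i2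
  rw [functional_eq hab hL (add_mem_C1 hX hZ), functional_eq hab hL hX, firstVariation,
    ← integral_sub i1 i2, ← integral_sub i12 i3]
  have i4 := (memLp_jet (μ := μ) hab hZ).integrable_norm_pow (p := 2) (by norm_num)
  refine (norm_integral_le_of_norm_le (i4.const_mul K) ?_).trans ?_
  · filter_upwards [jet_add (μ := μ) hab hX hZ] with p hp
    rw [hp]
    exact hK _ _
  · rw [integral_const_mul]
    have h := integral_jet_sq_le (μ := μ) hab hZ
    calc _ ≤ K * ((jetBound d μ * (c1Norm P past fut a b Z).toReal) ^ 2 * (b - a)) := by gcongr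
      _ = _ := by ring

theorem isDifferentialAt_firstVariation (hab : a ≤ b) (hL : BoundedSecondDerivs L)
    {X : ℝ → Ω → RVec d} (hX : X ∈ C1 P past fut a b) :
    IsDifferentialAt P past fut a b μ L (C1 P past fut a b) X
      (firstVariation P past fut a b μ L X) := by
  rw [IsDifferentialAt, admissibleVariations_eq hab hL]
  refine ⟨fun Z hZ W hW r s => firstVariation_smul_add_smul hab hL hX hZ hW r s, fun ε hε => ?_⟩
  obtain ⟨K, hK0, hK⟩ := exists_firstVariation_bound (μ := μ) hab hL hX
  refine ⟨ε / (K + 1), by positivity, fun Z hZ hδ => (hK Z hZ).trans ?_⟩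
  set c := (c1Norm P past fut a b Z).toReal
  have hc : 0 ≤ c := ENNReal.toReal_nonneg
  rw [le_div_iff₀ (by positivity)] at hδ
  nlinarith

theorem c1Norm_smul_le {Z : ℝ → Ω → RVec d} (hZ : Z ∈ C1 P past fut a b) {r : ℝ} (hr : 0 ≤ r) :
    (c1Norm P past fut a b (r • Z)).toReal ≤ r * (c1Norm P past fut a b Z).toReal := by
  have h := (hasC1Derivs_of_mem_C1 hZ).const_smul r
  have h1 : c1Norm P past fut a b (r • Z) ≤ ENNReal.ofReal r * c1Norm P past fut a b Z := by
    refine iSup₂_le fun t ht => ?_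
    rw [← eLpNorm_congr_ae (h.fwd_ae_eq t ht), ← eLpNorm_congr_ae (h.bwd_ae_eq t ht)]
    simp only [Pi.smul_apply]
    rw [eLpNorm_const_smul, eLpNorm_const_smul, eLpNorm_const_smul, ← mul_add, ← mul_add,
      Real.enorm_of_nonneg hr]
    gcongr
    exact le_iSup₂ (f := fun t (_ : t ∈ Ioo a b) => eLpNorm (Z t) 2 P
      + eLpNorm (fwd P past a b Z t) 2 P + eLpNorm (bwd P fut a b Z t) 2 P) t ht
  refine (ENNReal.toReal_mono (ENNReal.mul_lt_top ENNReal.ofReal_lt_top hZ.2).ne h1).trans ?_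
  rw [ENNReal.toReal_mul, ENNReal.toReal_ofReal hr]

/-- The differential is unique. -/
theorem IsDifferentialAt.unique (hab : a ≤ b) (hL : BoundedSecondDerivs L)
    {X : ℝ → Ω → RVec d} {G G' : (ℝ → Ω → RVec d) → ℂ}
    (hG : IsDifferentialAt P past fut a b μ L (C1 P past fut a b) X G)
    (hG' : IsDifferentialAt P past fut a b μ L (C1 P past fut a b) X G')
    {Z : ℝ → Ω → RVec d} (hZ : Z ∈ C1 P past fut a b) : G Z = G' Z := by
  rw [IsDifferentialAt, admissibleVariations_eq hab hL] at hG hG'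
  set c := (c1Norm P past fut a b Z).toReal with hc
  have hc0 : 0 ≤ c := ENNReal.toReal_nonneg
  have key : ∀ ε : ℝ, 0 < ε → ‖G Z - G' Z‖ ≤ 2 * ε * c := by
    intro ε hε
    obtain ⟨δ, hδ, h1⟩ := hG.2 ε hε
    obtain ⟨δ', hδ', h2⟩ := hG'.2 ε hε
    -- The direction is shrunk until both estimates apply, then the factor `r` is cancelled by
    -- linearity. The summand 1 covers the case of norm zero.
    set r := min δ δ' / (c + 1) with hr
    have hmin : 0 < min δ δ' := lt_min hδ hδ'
    have hr0 : 0 < r := by positivity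
    have hn := c1Norm_smul_le hZ hr0.le
    have hrc : r * c ≤ min δ δ' := by
      rw [hr, div_mul_eq_mul_div, div_le_iff₀ (by positivity)]
      nlinarith
    have hmem : r • Z ∈ C1 P past fut a b := by
      simpa using smul_add_smul_mem_C1 hZ hZ r 0
    have b1 := h1 _ hmem (hn.trans (hrc.trans (min_le_left _ _)))
    have b2 := h2 _ hmem (hn.trans (hrc.trans (min_le_right _ _)))
    have e1 : G (r • Z) = r * G Z := by simpa using hG.1 Z hZ Z hZ r 0
    have e2 : G' (r • Z) = r * G' Z := by simpa using hG'.1 Z hZ Z hZ r 0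
    rw [e1] at b1
    rw [e2] at b2
    have e3 : ‖(r : ℂ) * (G Z - G' Z)‖ ≤ 2 * ε * (r * c) := by
      have e4 : (r : ℂ) * (G Z - G' Z)
          = (functional P past fut a b μ L (X + r • Z) - functional P past fut a b μ L X
            - r * G' Z) - (functional P past fut a b μ L (X + r • Z)
            - functional P past fut a b μ L X - r * G Z) := by ring
      rw [e4]
      refine (norm_sub_le _ _).trans ((add_le_add b2 b1).trans ?_)
      nlinarith
    rw [norm_mul, Complex.norm_real, Real.norm_of_nonneg hr0.le] at e3
    have e5 : r * ‖G Z - G' Z‖ ≤ r * (2 * ε * c) := by linarith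
    exact le_of_mul_le_mul_left e5 hr0
  have h0 : ‖G Z - G' Z‖ ≤ 0 := by
    refine le_of_forall_pos_le_add fun ε hε => ?_
    refine (key (ε / (2 * (c + 1))) (by positivity)).trans ?_
    rw [zero_add]
    have : 2 * (ε / (2 * (c + 1))) * c = ε * (c / (c + 1)) := by field_simp
    rw [this]
    have h1 : c / (c + 1) ≤ 1 := (div_le_one (by positivity)).2 (by linarith)
    nlinarith
  exact sub_eq_zero.1 (norm_le_zero_iff.1 h0)

end Jet

/-! ### The Euler–Lagrange process and the fundamental lemma. -/

section EulerLagrange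

variable {Ω : Type*} {m0 : MeasurableSpace Ω} {P : Measure Ω} [IsFiniteMeasure P]
  {past : Filtration ℝ m0} {fut : Filtration ℝᵒᵈ m0} {a b : ℝ} {d : ℕ} {μ : ℝ}
  {L : RVec d → CVec d → ℂ}

/-- The process ∂_v L(X, 𝒟_μ X) is only known to have a C¹ version; this transfers the derivatives
of the version to it. -/
theorem HasC1Derivs.fwd_bwd_ae_eq_of_version {E : Type*} [NormedAddCommGroup E] [NormedSpace ℝ E]
    [CompleteSpace E] [SecondCountableTopology E] {A Z V U : ℝ → Ω → E}
    (h : HasC1Derivs P past fut a b Z V U) (hA : ∀ t ∈ Ioo a b, A t =ᵐ[P] Z t) {t : ℝ}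
    (ht : t ∈ Ioo a b) :
    fwd P past a b A t =ᵐ[P] V t ∧ bwd P fut a b A t =ᵐ[P] U t := by
  have hf : ∀ t ∈ Ioo a b, HasForwardDeriv P past A t (V t) := fun t ht =>
    (h.forward t ht).congr_process ht fun s hs => (hA s hs).symm
  have hb : ∀ t ∈ Ioo a b, HasBackwardDeriv P fut A t (U t) := fun t ht =>
    (h.backward t ht).congr_process ht fun s hs => (hA s hs).symm
  exact ⟨((fwd_spec_of_exists hf h.cont_forward).2 t ht).unique (hf t ht),
    ((bwd_spec_of_exists hb h.cont_backward).2 t ht).unique (hb t ht)⟩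

/-- The left side of the Euler-Lagrange equation. -/
def elProcess (P : Measure Ω) (past : Filtration ℝ m0) (fut : Filtration ℝᵒᵈ m0) (a b μ : ℝ)
    (L : RVec d → CVec d → ℂ) (X : ℝ → Ω → RVec d) : ℝ → Ω → CVec d := fun t ω =>
  dxAlong P past fut a b μ L X t ω
    - nelsonC P past fut a b (-μ) (dvAlong P past fut a b μ L X) t ω

theorem pairing_dotR_smul (c : ℂ) (u : Ω → CVec d) (z : Ω → RVec d) :
    pairing P (dotR d) (c • u) z = c * pairing P (dotR d) u z := by
  simp only [pairing, Pi.smul_apply, dotR_smul]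
  exact integral_const_mul _ _

theorem elProcess_ae_eq {X : ℝ → Ω → RVec d} {V D U : ℝ → Ω → CVec d}
    (hV : HasC1Derivs P past fut a b V D U)
    (hXV : ∀ t ∈ Ioo a b, dvAlong P past fut a b μ L X t =ᵐ[P] V t) {t : ℝ} (ht : t ∈ Ioo a b) :
    elProcess P past fut a b μ L X t =ᵐ[P]
      dxAlong P past fut a b μ L X t - (coef (-μ) • D t + coef μ • U t) := by
  obtain ⟨h1, h2⟩ := hV.fwd_bwd_ae_eq_of_version hXV ht
  filter_upwards [h1, h2] with ω h1 h2
  simp only [elProcess, nelsonC, combine_eq, neg_neg, h1, h2, Pi.sub_apply, Pi.add_apply,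
    Pi.smul_apply]

/-- The first variation in the direction of a process vanishing at the end points. -/
theorem firstVariation_eq_integral (hab : a < b) (hA : Admissible L) (hL : BoundedSecondDerivs L)
    {X Z : ℝ → Ω → RVec d} (hX : X ∈ LAdapted P past fut a b μ L) (hZ : Z ∈ C1 P past fut a b)
    (hZa : Z a =ᵐ[P] 0) (hZb : Z b =ᵐ[P] 0) :
    firstVariation P past fut a b μ L X Z
      = ∫ t in Ioo a b, pairing P (dotR d) (elProcess P past fut a b μ L X t) (Z t) := by
  obtain ⟨hX1, hdx, V, hV, hXV⟩ := hX
  have hV' := hasC1Derivs_of_mem_C1 hV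
  have hZ' := hasC1Derivs_of_mem_C1 hZ
  set D := fwd P past a b V
  set U := bwd P fut a b V
  -- Integration by parts is used twice: here with D on V and D_* on Z, then with the roles
  -- exchanged.
  obtain ⟨i1, i2, e1⟩ := integral_pairing_by_parts (dotR d) hab hV' hZ'
  obtain ⟨i3, i4, e2⟩ := integral_pairing_by_parts (dotR d).flip hab hZ' hV'
  simp only [pairing_flip] at i3 i4 e2
  have z1 : pairing P (dotR d) (V b) (Z b) = 0 := by
    rw [pairing_congr (dotR d) (EventuallyEq.refl _ (V b)) hZb]
    simp [pairing]
  have z2 : pairing P (dotR d) (V a) (Z a) = 0 := by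
    rw [pairing_congr (dotR d) (EventuallyEq.refl _ (V a)) hZa]
    simp [pairing]
  rw [z1, z2, sub_zero] at e1 e2
  set p1 := fun t => pairing P (dotR d) (V t) (fwd P past a b Z t)
  set p2 := fun t => pairing P (dotR d) (V t) (bwd P fut a b Z t)
  set q1 := fun t => pairing P (dotR d) (U t) (Z t)
  set q2 := fun t => pairing P (dotR d) (D t) (Z t)
  have hint := integrable_firstVariation (μ := μ) hab.le hL hX1 hZ
  have hint' := hint.integral_prod_left
  set T := fun t => ∫ ω, totalDeriv L (jet P past fut a b μ X t ω) (jet P past fut a b μ Z t ω) ∂P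
  have hT : IntegrableOn T (Ioo a b) := hint'
  have hFT : firstVariation P past fut a b μ L X Z = ∫ t in Ioo a b, T t := by
    rw [firstVariation, timeChance, integral_prod _ hint]
    rfl
  -- The terms are grouped by coefficient. Each bracket, E[V·DZ] + E[D_*V·Z] and E[DV·Z] +
  -- E[V·D_*Z], is the derivative of E[V·Z] and integrates to zero.
  have key : ∀ t ∈ Ioo a b, pairing P (dotR d) (elProcess P past fut a b μ L X t) (Z t)
      = T t - coef μ * (p1 t + q1 t) - coef (-μ) * (q2 t + p2 t) := by
    intro t ht
    have mZ := hZ'.isS0.memLp_Ioo ht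
    have mf := hZ'.memLp_forward t ht
    have mb := hZ'.memLp_backward t ht
    have mV := hV'.isS0.memLp_Ioo ht
    have mD := hV'.memLp_forward t ht
    have mU := hV'.memLp_backward t ht
    have mx := (hdx t ht).2.2
    have hTt : T t = pairing P (dotR d) (dxAlong P past fut a b μ L X t) (Z t)
        + coef μ * p1 t + coef (-μ) * p2 t := by
      have j1 := integrable_bilin (dotR d) mx mZ
      have j2 := (integrable_bilin (dotR d) mV mf).const_mul (coef μ)
      have j3 := (integrable_bilin (dotR d) mV mb).const_mul (coef (-μ))
      have e3 : ∫ ω, (dotR d (dxAlong P past fut a b μ L X t ω) (Z t ω)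
          + coef μ * dotR d (V t ω) (fwd P past a b Z t ω)
          + coef (-μ) * dotR d (V t ω) (bwd P fut a b Z t ω)) ∂P = _ :=
        integral_add (j1.add j2) j3
      simp only [p1, p2, pairing, ← integral_const_mul]
      rw [← integral_add j1 j2, ← e3]
      refine integral_congr_ae ?_
      filter_upwards [hXV t ht] with ω hω
      have e : jet P past fut a b μ Z t ω = (Z t ω, nelsonL d μ (fwd P past a b Z t ω)
          + nelsonL d (-μ) (bwd P fut a b Z t ω)) := by
        simp only [jet, nelson, combine_toC]
      rw [e, jet, totalDeriv_eq_dot hA hL, ← hω, add_assoc]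
      congr 1
      rw [← sum_mul_nelsonL, ← sum_mul_nelsonL, ← Finset.sum_add_distrib]
      refine Finset.sum_congr rfl fun k _ => ?_
      rw [PiLp.add_apply, mul_add]
      rfl
    rw [pairing_congr (dotR d) (elProcess_ae_eq hV' hXV ht) (EventuallyEq.refl _ (Z t)),
      pairing_sub_left (dotR d) mx ((mD.const_smul _).add (mU.const_smul _)) mZ,
      pairing_add_left (dotR d) (mD.const_smul _) (mU.const_smul _) mZ, pairing_dotR_smul,
      pairing_dotR_smul, hTt]
    ring
  rw [setIntegral_congr_fun measurableSet_Ioo key, hFT]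
  have k1 : ∫ t in Ioo a b, coef μ * (p1 t + q1 t) = 0 := by
    rw [integral_const_mul, integral_add i3 i4, e2, mul_zero]
  have k2 : ∫ t in Ioo a b, coef (-μ) * (q2 t + p2 t) = 0 := by
    rw [integral_const_mul, integral_add i1 i2, e1, mul_zero]
  have l1 : IntegrableOn (fun t => coef μ * (p1 t + q1 t)) (Ioo a b) := (i3.add i4).const_mul _
  have l2 : IntegrableOn (fun t => coef (-μ) * (q2 t + p2 t)) (Ioo a b) := (i1.add i2).const_mul _
  have l3 : IntegrableOn (fun t => T t - coef μ * (p1 t + q1 t)) (Ioo a b) := hT.sub l1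
  rw [integral_sub l3 l2, integral_sub hT l1, k1, k2, sub_zero, sub_zero]

/-- If `X ∈ C³(I)`, the process `𝒟_{-μ}[∂_v L(X, 𝒟_μ X)]` belongs to `C¹_ℂ(I)`, because `∂_v L` is
affine. -/
theorem exists_C1_elProcess (hA : Admissible L) (hL : BoundedSecondDerivs L)
    {X : ℝ → Ω → RVec d} (hX3 : X ∈ Cn P past fut a b 3)
    (hdx : HasC1Version P past fut a b (dxAlong P past fut a b μ L X)) :
    HasC1Version P past fut a b (elProcess P past fut a b μ L X) := by
  obtain ⟨hX, ⟨Y, ⟨hY, ⟨Y1, hY1, hYY1⟩, ⟨Y2, hY2, hYY2⟩⟩, hXY⟩,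
    ⟨S, ⟨hS, ⟨S1, hS1, hSS1⟩, ⟨S2, hS2, hSS2⟩⟩, hXS⟩⟩ := hX3
  obtain ⟨G, hG, hGx⟩ := hdx
  obtain ⟨c, T, hT⟩ := exists_dv_eq hA hL
  have hX' := hasC1Derivs_of_mem_C1 hX
  have eY : ∀ t ∈ Ioo a b, fwd P past a b X t =ᵐ[P] Y t := fun t ht =>
    (hX'.forward t ht).unique (hXY t ht)
  have eS : ∀ t ∈ Ioo a b, bwd P fut a b X t =ᵐ[P] S t := fun t ht =>
    (hX'.backward t ht).unique (hXS t ht)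
  have hXd : HasC1Derivs P past fut a b X Y S := hX'.congr eY eS
  have hYd : HasC1Derivs P past fut a b Y Y1 Y2 := (hasC1Derivs_of_mem_C1 hY).congr
    (fun t ht => ((hasC1Derivs_of_mem_C1 hY).forward t ht).unique (hYY1 t ht))
    (fun t ht => ((hasC1Derivs_of_mem_C1 hY).backward t ht).unique (hYY2 t ht))
  have hSd : HasC1Derivs P past fut a b S S1 S2 := (hasC1Derivs_of_mem_C1 hS).congr
    (fun t ht => ((hasC1Derivs_of_mem_C1 hS).forward t ht).unique (hSS1 t ht))
    (fun t ht => ((hasC1Derivs_of_mem_C1 hS).backward t ht).unique (hSS2 t ht))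
  let T1 : RVec d →L[ℝ] CVec d := T.comp (ContinuousLinearMap.inl ℝ _ _)
  let T2 : RVec d →L[ℝ] CVec d := (T.comp (ContinuousLinearMap.inr ℝ _ _)).comp (nelsonL d μ)
  let T3 : RVec d →L[ℝ] CVec d := (T.comp (ContinuousLinearMap.inr ℝ _ _)).comp (nelsonL d (-μ))
  -- By affinity ∂_v L = c + T1 X + T2 DX + T3 D_*X. Its Nelson derivatives involve only derivatives
  -- of X up to order two, all of class C¹; `hF` and `hB` are these derivatives times the negatives
  -- of the coefficients of 𝒟_{-μ}.
  have hV := (((hasC1Derivs_const (P := P) (past := past) (fut := fut) (a := a) (b := b)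
    c).add (hXd.clm T1)).add (hYd.clm T2)).add (hSd.clm T3)
  have hF := ((((hasC1Derivs_const (P := P) (past := past) (fut := fut) (a := a) (b := b)
    (0 : CVec d)).add (hYd.clm T1)).add ((hasC1Derivs_of_mem_C1 hY1).clm T2)).add
    ((hasC1Derivs_of_mem_C1 hS1).clm T3)).clm ((-coef (-μ)) • ContinuousLinearMap.id ℝ (CVec d))
  have hB := ((((hasC1Derivs_const (P := P) (past := past) (fut := fut) (a := a) (b := b)
    (0 : CVec d)).add (hSd.clm T1)).add ((hasC1Derivs_of_mem_C1 hY2).clm T2)).add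
    ((hasC1Derivs_of_mem_C1 hS2).clm T3)).clm ((-coef μ) • ContinuousLinearMap.id ℝ (CVec d))
  refine ⟨_, (((hasC1Derivs_of_mem_C1 hG).add hF).add hB).mem_C1, fun t ht => ?_⟩
  refine (elProcess_ae_eq hV (fun t ht => ?_) ht).trans ?_
  · filter_upwards [eY t ht, eS t ht] with ω h1 h2
    simp only [dvAlong, hT, nelson, combine_toC, h1, h2, Pi.add_apply]
    have e : (X t ω, nelsonL d μ (Y t ω) + nelsonL d (-μ) (S t ω))
        = ContinuousLinearMap.inl ℝ (RVec d) (CVec d) (X t ω)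
        + ContinuousLinearMap.inr ℝ (RVec d) (CVec d) (nelsonL d μ (Y t ω))
        + ContinuousLinearMap.inr ℝ (RVec d) (CVec d) (nelsonL d (-μ) (S t ω)) := by simp
    rw [e, map_add, map_add, ← add_assoc, ← add_assoc]
    rfl
  · filter_upwards [hGx t ht] with ω h1
    simp only [Pi.sub_apply, Pi.add_apply, Pi.smul_apply, h1, _root_.smul_apply,
      ContinuousLinearMap.id_apply, neg_smul]
    abel

/-- The real part of a vector. -/
def reL (d : ℕ) : CVec d →L[ℝ] RVec d :=
  LinearMap.toContinuousLinearMap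
    { toFun := fun u => WithLp.toLp 2 fun k => (u k).re
      map_add' := fun x y => by ext k; simp
      map_smul' := fun r x => by ext k; simp }

/-- The imaginary part of a vector. -/
def imL (d : ℕ) : CVec d →L[ℝ] RVec d :=
  LinearMap.toContinuousLinearMap
    { toFun := fun u => WithLp.toLp 2 fun k => (u k).im
      map_add' := fun x y => by ext k; simp
      map_smul' := fun r x => by ext k; simp }

/-- Variations are real, so conj u is not available as a test vector; it is assembled from two real
ones as Re u - i Im u. -/
theorem dotR_re_sub_im (u : CVec d) :
    dotR d u (reL d u) - Complex.I * dotR d u (imL d u) = ((‖u‖ ^ 2 : ℝ) : ℂ) := by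
  rw [dotR_apply, dotR_apply, Finset.mul_sum, ← Finset.sum_sub_distrib, EuclideanSpace.norm_sq_eq,
    Complex.ofReal_sum]
  refine Finset.sum_congr rfl fun k _ => ?_
  have h1 : reL d u k = (u k).re := rfl
  have h2 : imL d u k = (u k).im := rfl
  rw [h1, h2, ← Complex.normSq_eq_norm_sq, ← Complex.mul_conj]
  have h3 : (starRingEnd ℂ) (u k) = (u k).re - Complex.I * (u k).im := by
    apply Complex.ext <;> simp
  rw [h3]
  ring

theorem pairing_re_sub_im {u : Ω → CVec d} (hu : MemLp u 2 P) :
    pairing P (dotR d) u (fun ω => reL d (u ω)) - Complex.I * pairing P (dotR d) u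
      (fun ω => imL d (u ω)) = ((∫ ω, ‖u ω‖ ^ 2 ∂P : ℝ) : ℂ) := by
  have h1 := integrable_bilin (dotR d) hu ((reL d).comp_memLp' hu)
  have h2 := (integrable_bilin (dotR d) hu ((imL d).comp_memLp' hu)).const_mul Complex.I
  rw [pairing, pairing, ← integral_const_mul, ← integral_complex_ofReal]
  simp only [← dotR_re_sub_im]
  exact (integral_sub h1 h2).symm

/-- The fundamental lemma of the calculus of variations for processes of class `C¹`. -/
theorem ae_eq_zero_of_forall_pairing_eq_zero {W : ℝ → Ω → CVec d}
    (hW : W ∈ C1 P past fut a b)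
    (h : ∀ Z ∈ C1 P past fut a b, Z a =ᵐ[P] 0 → Z b =ᵐ[P] 0 →
      ∫ t in Ioo a b, pairing P (dotR d) (W t) (Z t) = 0) :
    ∀ t ∈ Ioo a b, W t =ᵐ[P] 0 := by
  have hW' := hasC1Derivs_of_mem_C1 hW
  have mW : ∀ t ∈ Ioo a b, MemLp (W t) 2 P := fun t ht => hW'.isS0.memLp_Ioo ht
  -- Positive inside the interval and zero at its ends, so that φ·R(W) is an allowed variation for
  -- every real-linear `R`.
  let φ : ℝ → ℝ := fun t => (t - a) * (b - t)
  have hφ : ∀ t, HasDerivAt φ (1 * (b - t) + (t - a) * -1) t := fun t =>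
    ((hasDerivAt_id t).sub_const a).mul ((hasDerivAt_id t).const_sub b)
  have hφ' : Continuous fun t : ℝ => 1 * (b - t) + (t - a) * -1 := by fun_prop
  have hφc : Continuous φ := by fun_prop
  have key : ∀ R : CVec d →L[ℝ] RVec d,
      ∫ t in Ioo a b, (φ t : ℂ) * pairing P (dotR d) (W t) (fun ω => R (W t ω)) = 0 := by
    intro R
    have hZ := (hW'.clm R).smul_fun hφ hφ'
    have e := h _ hZ.mem_C1 (ae_of_all _ fun ω => by simp [φ]) (ae_of_all _ fun ω => by simp [φ])
    rw [← e]
    refine setIntegral_congr_fun measurableSet_Ioo fun t ht => ?_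
    simp only [pairing_smul_right, Complex.real_smul]
  have bnd : ∀ R : CVec d →L[ℝ] RVec d, IntegrableOn
      (fun t => (φ t : ℂ) * pairing P (dotR d) (W t) (fun ω => R (W t ω))) (Ioo a b) := by
    intro R
    have hZ := (hW'.clm R).smul_fun hφ hφ'
    obtain ⟨M, hM, hMb⟩ := hW'.bounded
    obtain ⟨N, hN, hNb⟩ := hZ.bounded
    refine (integrableOn_pairing (dotR d) hW'.isS0.l2ContinuousOn hZ.isS0.l2ContinuousOn mW
      (fun t ht => hZ.isS0.memLp_Ioo ht) hM hN (fun t ht => (hMb t ht).1)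
      fun t ht => (hNb t ht).1).congr_fun (fun t _ => ?_) measurableSet_Ioo
    simp only [pairing_smul_right, Complex.real_smul]
  let g : ℝ → ℂ := fun t => pairing P (dotR d) (W t) (fun ω => reL d (W t ω))
    - Complex.I * pairing P (dotR d) (W t) (fun ω => imL d (W t ω))
  have hg : ∀ t ∈ Ioo a b, g t = ((∫ ω, ‖W t ω‖ ^ 2 ∂P : ℝ) : ℂ) := fun t ht =>
    pairing_re_sub_im (mW t ht)
  have hgc : ContinuousOn g (Ioo a b) := by
    have c : ∀ R : CVec d →L[ℝ] RVec d,
        ContinuousOn (fun t => pairing P (dotR d) (W t) (fun ω => R (W t ω))) (Ioo a b) :=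
      fun R => continuousOn_pairing (dotR d) hW'.isS0.l2ContinuousOn
        (hW'.isS0.l2ContinuousOn.clm R) mW fun t ht => R.comp_memLp' (mW t ht)
    exact (c _).sub (continuousOn_const.mul (c _))
  have hint : IntegrableOn (fun t => (φ t : ℂ) * g t) (Ioo a b) := by
    refine ((bnd (reL d)).sub ((bnd (imL d)).const_mul Complex.I)).congr_fun
      (fun t _ => ?_) measurableSet_Ioo
    simp only [g, Pi.sub_apply]
    ring
  have hzero : ∫ t in Ioo a b, (φ t : ℂ) * g t = 0 := by
    have e := integral_sub (bnd (reL d)) ((bnd (imL d)).const_mul Complex.I)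
    rw [integral_const_mul, key, key, mul_zero, sub_zero] at e
    rw [← e]
    refine setIntegral_congr_fun measurableSet_Ioo fun t _ => ?_
    simp only [g]
    ring
  let f : ℝ → ℝ := fun t => ((φ t : ℂ) * g t).re
  have hf : ∀ t ∈ Ioo a b, f t = φ t * ∫ ω, ‖W t ω‖ ^ 2 ∂P := by
    intro t ht
    simp only [f]
    rw [hg t ht, ← Complex.ofReal_mul, Complex.ofReal_re]
  have hfc : ContinuousOn f (Ioo a b) :=
    Complex.continuous_re.comp_continuousOn
      ((Complex.continuous_ofReal.comp hφc).continuousOn.mul hgc)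
  have hf0 : ∫ t in Ioo a b, f t = 0 := by
    have := integral_re hint
    simp only [RCLike.re_eq_complex_re] at this
    rw [this, hzero, Complex.zero_re]
  have hfpos : ∀ t ∈ Ioo a b, 0 ≤ f t := by
    intro t ht
    rw [hf t ht]
    exact mul_nonneg (mul_nonneg (sub_nonneg.2 ht.1.le) (sub_nonneg.2 ht.2.le))
      (integral_nonneg fun _ => by positivity)
  have hae := (setIntegral_eq_zero_iff_of_nonneg_ae
    ((ae_restrict_mem measurableSet_Ioo).mono hfpos) hint.re).1 hf0
  -- Vanishing for almost every time becomes vanishing at every time, because t ↦ E|W_t|² is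
  -- continuous.
  have hall : EqOn f 0 (Ioo a b) :=
    Measure.eqOn_open_of_ae_eq hae isOpen_Ioo hfc continuousOn_const
  intro t ht
  have h0 := hall ht
  rw [hf t ht] at h0
  have hφt : φ t ≠ 0 := (mul_pos (sub_pos.2 ht.1) (sub_pos.2 ht.2)).ne'
  have h1 : ∫ ω, ‖W t ω‖ ^ 2 ∂P = 0 := (mul_eq_zero.1 h0).resolve_left hφt
  rw [integral_eq_zero_iff_of_nonneg (fun _ => by positivity)
    ((mW t ht).integrable_norm_pow (by norm_num))] at h1
  filter_upwards [h1] with ω hω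
  simpa using hω

end EulerLagrange

end StochCV

end

/-! ### The theorem. -/

theorem mainTheorem2 {Ω : Type*} {m0 : MeasurableSpace Ω} (P : Measure Ω)
    [IsProbabilityMeasure P] (past : Filtration ℝ m0) (fut : Filtration ℝᵒᵈ m0)
    (a b : ℝ) (hab : a < b) (d : ℕ) (μ : ℝ) (hμ : μ = 1 ∨ μ = -1)
    (L : StochCV.RVec d → StochCV.CVec d → ℂ) (hL : StochCV.Admissible L)
    (hL2 : StochCV.BoundedSecondDerivs L) (X : ℝ → Ω → StochCV.RVec d)
    (hXL : X ∈ StochCV.LAdapted P past fut a b μ L)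
    (hX3 : X ∈ StochCV.Cn P past fut a b 3) :
    (StochCV.EulerLagrange P past fut a b μ L X →
      StochCV.IsCritical P past fut a b μ L (StochCV.C1 P past fut a b) X) ∧
    (StochCV.HasC1Version P past fut a b (StochCV.dxAlong P past fut a b μ L X) →
      (StochCV.IsCritical P past fut a b μ L (StochCV.C1 P past fut a b) X ↔
        StochCV.EulerLagrange P past fut a b μ L X)) := by
  have hX1 := hXL.1
  have hXi : X ∈ StochCV.Xi P past fut a b μ L := StochCV.mem_Xi_of_mem_C1 hab.le hL2 hX1
  have hcrit : StochCV.EulerLagrange P past fut a b μ L X →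
      StochCV.IsCritical P past fut a b μ L (StochCV.C1 P past fut a b) X := by
    intro hEL
    refine ⟨hXi, hXL, StochCV.firstVariation P past fut a b μ L X,
      StochCV.isDifferentialAt_firstVariation hab.le hL2 hX1, fun Z hZ hZa hZb => ?_⟩
    rw [StochCV.firstVariation_eq_integral hab hL hL2 hXL hZ.1 hZa hZb]
    refine setIntegral_eq_zero_of_forall_eq_zero fun t ht => ?_
    have h0 : StochCV.elProcess P past fut a b μ L X t =ᵐ[P] 0 := hEL t ht
    rw [StochCV.pairing_congr (StochCV.dotR d) h0 (EventuallyEq.refl _ (Z t))]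
    simp [StochCV.pairing]
  refine ⟨hcrit, fun hdx => ⟨fun hc => ?_, hcrit⟩⟩
  obtain ⟨-, -, dF, hdF, hdF0⟩ := hc
  -- The equation concerns the left side only up to null sets at each time, so a C¹ version may take
  -- its place and act as a variation.
  obtain ⟨W, hW, hXW⟩ := StochCV.exists_C1_elProcess hL hL2 hX3 hdx
  have hzero := StochCV.ae_eq_zero_of_forall_pairing_eq_zero hW fun Z hZ hZa hZb => by
    have e1 := hdF0 Z (by rw [StochCV.admissibleVariations_eq hab.le hL2]; exact hZ) hZa hZb
    rw [hdF.unique hab.le hL2 (StochCV.isDifferentialAt_firstVariation hab.le hL2 hX1) hZ,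
      StochCV.firstVariation_eq_integral hab hL hL2 hXL hZ hZa hZb] at e1
    rw [← e1]
    exact setIntegral_congr_fun measurableSet_Ioo fun t ht =>
      (StochCV.pairing_congr (StochCV.dotR d) (hXW t ht) (EventuallyEq.refl _ (Z t))).symm
  exact fun t ht => (hXW t ht).trans (hzero t ht)
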